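/- Let $\Bbbk=\mathbb{C}$ and $\mathrm{i}=\sqrt{-1}$. Let $H$ be one of the two Hopf algebras (Kashina #2 and Kashina #4) defined as follows: $H$ is generated as an algebra by $x,y,z,w$ subject to $x^2=y^2=z^2=1$, $xy=yx$, $xz=zx$, $yz=zy$, $wx=yw$, $wy=xw$, $wz=zw$, and $$w^2=1 \ \text{ for Kashina \#2}, \qquad w^2=z \ \text{ for Kashina \#4};$$ $x,y,z$ are grouplike, $\epsilon(w)=1$, and $$\Delta(w)=\tfrac12\,(1\otimes 1+1\otimes xy+z\otimes 1-z\otimes xy)(w\otimes w).$$ For $i\in\{1,2\}$ let $\pi_i(u,v)$ be the two-dimensional representation of $H$ with basis $u,v$ in which $$\pi_i(x)=\begin{bmatrix}1&0\\0&-1\end{bmatrix},\quad \pi_i(y)=\begin{bmatrix}-1&0\\0&1\end{bmatrix},\quad \pi_i(z)=(-1)^{i+1}\begin{bmatrix}1&0\\0&1\end{bmatrix},\quad \pi_i(w)=c_i\begin{bmatrix}0&1\\1&0\end{bmatrix},$$ where $c_1=c_2=1$ for Kashina #2, and $c_1=1$, $c_2=\mathrm{i}$ for Kashina #4. Let $T(t)=\Bbbk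 t$ be any one-dimensional representation of $H$ with $z.t=-t$. Let $r$ be one of $u^2+v^2$, $u^2-v^2$, $uv+vu$, $uv-vu$, let $\alpha\in\Bbbk$ be nonzero, let $\sigma$ be the automorphism of $\Bbbk\langle u,v\rangle/(r)$ with $\sigma(u)=\alpha u$ and $\sigma(v)=-\alpha v$, and let $$A=\frac{\Bbbk\langle u,v\rangle}{(r)}[t;\sigma]$$ be the Ore extension (with $tb=\sigma(b)t$), graded with $u,v,t$ in degree one. Then $H$ acts inner-faithfully on $A$ with $A_1$ the representation $\pi_i(u,v)\oplus T(t)$. That is, $u,v,t$ are linearly independent in $A$, and there is an $H$-module structure on $A$ that makes $A$ an $H$-module algebra (i.e. $h.1=\epsilon(h)1$ and $h.(ab)=\sum (h_1.a)(h_2.b)$), preserves the grading, restricts to $\pi_i(u,v)\oplus T(t)$ on $A_1=\Bbbk u\oplus\Bbbk v\oplus\Bbbk t$, and is such that no nonzero Hopf ideal of $H$ annihilates $A$. -/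

import Mathlib

open scoped TensorProduct

set_option linter.unusedSimpArgs false
set_option linter.unusedTactic false
set_option linter.unreachableTactic false

namespace KashinaSixteen

/-! ### General notions: module algebras and inner-faithful modules -/

section General

variable {H : Type*} [Ring H] [HopfAlgebra ℂ H]

/-- A (left) `H`-module structure `ρ` on the algebra `A` makes `A` a (left) `H`-module algebra:
`h.1 = ε(h) 1` and `h.(ab) = ∑ (h₁.a)(h₂.b)`. -/
def IsModuleAlgebra {A : Type*} [Ring A] [Algebra ℂ A] (ρ : H →ₐ[ℂ] Module.End ℂ A) : Prop :=
  (∀ h : H, ρ h 1 = Coalgebra.counit (R := ℂ) h • (1 : A)) ∧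
  ∀ (h : H) (a b : A), ρ h (a * b) =
    LinearMap.mul' ℂ A
      (TensorProduct.map (ρ.toLinearMap.flip a) (ρ.toLinearMap.flip b)
        (Coalgebra.comul (R := ℂ) h))

/-- A module is inner-faithful if the only Hopf ideal that annihilates it is zero. -/
def IsInnerFaithful {M : Type*} [AddCommGroup M] [Module ℂ M]
    (ρ : H →ₐ[ℂ] Module.End ℂ M) : Prop :=
  ∀ I : Ideal H, I.IsTwoSided → I.IsHopfIdeal ℂ →
    (∀ h ∈ I, ∀ m : M, ρ h m = 0) → I = ⊥

end General

/-! ### The Hopf algebras Kashina #2 and Kashina #4 -/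

/-- Selects one of the two Hopf algebras: `two` is #2 and `four` is #4. -/
inductive Index
  | two
  | four

/-- The four algebra generators. -/
inductive Gen
  | x
  | y
  | z
  | w

/-- The free-algebra generator attached to `g`. -/
noncomputable abbrev free (g : Gen) : FreeAlgebra ℂ Gen := FreeAlgebra.ι ℂ g

/-- The right-hand side of the relation for `w²`: it is `1` for #2 and `z` for #4. -/
noncomputable def wSquare : Index → FreeAlgebra ℂ Gen
  | .two => 1
  | .four => free .z

/-- The defining relations: `⟨x⟩ × ⟨y⟩ × ⟨z⟩ = C₂ × C₂ × C₂`, `wx = yw`, `wy = xw`, `wz = zw`, and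
the relation for `w²`. -/
inductive Rel (k : Index) : FreeAlgebra ℂ Gen → FreeAlgebra ℂ Gen → Prop
  | x_sq : Rel k (free .x * free .x) 1
  | y_sq : Rel k (free .y * free .y) 1
  | z_sq : Rel k (free .z * free .z) 1
  | y_x : Rel k (free .y * free .x) (free .x * free .y)
  | z_x : Rel k (free .z * free .x) (free .x * free .z)
  | z_y : Rel k (free .z * free .y) (free .y * free .z)
  | w_x : Rel k (free .w * free .x) (free .y * free .w)
  | w_y : Rel k (free .w * free .y) (free .x * free .w)
  | w_z : Rel k (free .w * free .z) (free .z * free .w)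
  | w_sq : Rel k (free .w * free .w) (wSquare k)

/-- The algebra underlying Kashina #2 (`k = two`) and Kashina #4 (`k = four`). -/
def Kashina (k : Index) : Type := RingQuot (Rel k)

namespace Kashina

variable (k : Index)

noncomputable instance : Ring (Kashina k) := inferInstanceAs (Ring (RingQuot (Rel k)))

noncomputable instance : Algebra ℂ (Kashina k) :=
  inferInstanceAs (Algebra ℂ (RingQuot (Rel k)))

/-- The quotient map from the free algebra. -/
noncomputable def mk : FreeAlgebra ℂ Gen →ₐ[ℂ] Kashina k := RingQuot.mkAlgHom ℂ (Rel k)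

/-- The generators of the algebra. -/
noncomputable def gen (g : Gen) : Kashina k := mk k (free g)

/-- The value of `w²` in the algebra. -/
noncomputable def wSq : Kashina k := mk k (wSquare k)

lemma wSq_two : wSq .two = 1 := map_one _

lemma wSq_four : wSq .four = gen .four .z := rfl

section relations

variable {k}

lemma rel {a b : FreeAlgebra ℂ Gen} (h : Rel k a b) : mk k a = mk k b :=
  RingQuot.mkAlgHom_rel ℂ h

lemma xx : gen k .x * gen k .x = 1 := by simpa [gen] using rel (Rel.x_sq (k := k))
lemma yy : gen k .y * gen k .y = 1 := by simpa [gen] using rel (Rel.y_sq (k := k))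
lemma zz : gen k .z * gen k .z = 1 := by simpa [gen] using rel (Rel.z_sq (k := k))
lemma yx : gen k .y * gen k .x = gen k .x * gen k .y := by
  simpa [gen] using rel (Rel.y_x (k := k))
lemma zx : gen k .z * gen k .x = gen k .x * gen k .z := by
  simpa [gen] using rel (Rel.z_x (k := k))
lemma zy : gen k .z * gen k .y = gen k .y * gen k .z := by
  simpa [gen] using rel (Rel.z_y (k := k))
lemma wx : gen k .w * gen k .x = gen k .y * gen k .w := by
  simpa [gen] using rel (Rel.w_x (k := k))
lemma wy : gen k .w * gen k .y = gen k .x * gen k .w := by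
  simpa [gen] using rel (Rel.w_y (k := k))
lemma wz : gen k .w * gen k .z = gen k .z * gen k .w := by
  simpa [gen] using rel (Rel.w_z (k := k))
lemma ww : gen k .w * gen k .w = wSq k := by
  simpa [gen, wSq] using rel (Rel.w_sq (k := k))

lemma xx' (a : Kashina k) : gen k .x * (gen k .x * a) = a := by
  rw [← mul_assoc, xx, one_mul]
lemma yy' (a : Kashina k) : gen k .y * (gen k .y * a) = a := by
  rw [← mul_assoc, yy, one_mul]
lemma zz' (a : Kashina k) : gen k .z * (gen k .z * a) = a := by
  rw [← mul_assoc, zz, one_mul]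
lemma yx' (a : Kashina k) : gen k .y * (gen k .x * a) = gen k .x * (gen k .y * a) := by
  simp only [← mul_assoc, yx]
lemma zx' (a : Kashina k) : gen k .z * (gen k .x * a) = gen k .x * (gen k .z * a) := by
  simp only [← mul_assoc, zx]
lemma zy' (a : Kashina k) : gen k .z * (gen k .y * a) = gen k .y * (gen k .z * a) := by
  simp only [← mul_assoc, zy]
lemma wx' (a : Kashina k) : gen k .w * (gen k .x * a) = gen k .y * (gen k .w * a) := by
  simp only [← mul_assoc, wx]
lemma wy' (a : Kashina k) : gen k .w * (gen k .y * a) = gen k .x * (gen k .w * a) := by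
  simp only [← mul_assoc, wy]
lemma wz' (a : Kashina k) : gen k .w * (gen k .z * a) = gen k .z * (gen k .w * a) := by
  simp only [← mul_assoc, wz]
lemma ww' (a : Kashina k) : gen k .w * (gen k .w * a) = wSq k * a := by
  rw [← mul_assoc, ww]

lemma wSq_sq : wSq k * wSq k = 1 := by
  cases k
  · simp [wSq_two]
  · simp [wSq_four, zz]

end relations

/-- The universal property of the presentation. -/
noncomputable def lift {B : Type*} [Ring B] [Algebra ℂ B] (f : Gen → B)
    (h : ∀ ⦃a b⦄, Rel k a b → FreeAlgebra.lift ℂ f a = FreeAlgebra.lift ℂ f b) :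
    Kashina k →ₐ[ℂ] B :=
  RingQuot.liftAlgHom ℂ ⟨FreeAlgebra.lift ℂ f, h⟩

lemma lift_mk {B : Type*} [Ring B] [Algebra ℂ B] (f : Gen → B)
    (h : ∀ ⦃a b⦄, Rel k a b → FreeAlgebra.lift ℂ f a = FreeAlgebra.lift ℂ f b)
    (a : FreeAlgebra ℂ Gen) : lift k f h (mk k a) = FreeAlgebra.lift ℂ f a := by
  unfold lift mk
  exact RingQuot.liftAlgHom_mkAlgHom_apply ℂ _ h a

@[simp] lemma lift_gen {B : Type*} [Ring B] [Algebra ℂ B] (f : Gen → B)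
    (h : ∀ ⦃a b⦄, Rel k a b → FreeAlgebra.lift ℂ f a = FreeAlgebra.lift ℂ f b) (g : Gen) :
    lift k f h (gen k g) = f g := by
  rw [gen, lift_mk, FreeAlgebra.lift_ι_apply]

variable {k} in
lemma hom_ext {B : Type*} [Ring B] [Algebra ℂ B] {f g : Kashina k →ₐ[ℂ] B}
    (h : ∀ s, f (gen k s) = g (gen k s)) : f = g := by
  have : f.comp (mk k) = g.comp (mk k) := FreeAlgebra.hom_ext (funext h)
  ext a
  obtain ⟨a, rfl⟩ := RingQuot.mkAlgHom_surjective ℂ (Rel k) a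
  exact DFunLike.congr_fun this a

variable {k} in
lemma induction {P : Kashina k → Prop} (h0 : ∀ c : ℂ, P (algebraMap ℂ _ c))
    (h1 : ∀ g, P (gen k g)) (hm : ∀ a b, P a → P b → P (a * b))
    (ha : ∀ a b, P a → P b → P (a + b)) (a : Kashina k) : P a := by
  obtain ⟨a, rfl⟩ := RingQuot.mkAlgHom_surjective ℂ (Rel k) a
  change P (mk k a)
  induction a using FreeAlgebra.induction with
  | grade0 r => rw [AlgHom.commutes]; exact h0 r
  | grade1 g => exact h1 g
  | mul a b h1 h2 => rw [map_mul]; exact hm _ _ h1 h2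
  | add a b h1 h2 => rw [map_add]; exact ha _ _ h1 h2

/-- The counit on generators: `x`, `y`, `z`, `w` all go to `1`. -/
noncomputable def counitHom : Kashina k →ₐ[ℂ] ℂ :=
  lift k (fun _ => 1) (by
    intro a b h
    cases h <;> try simp
    cases k <;> simp [wSquare])

/-- The comultiplication on generators: `x`, `y`, `z` are grouplike, and
`Δ(w) = ½ (1 ⊗ 1 + 1 ⊗ xy + z ⊗ 1 - z ⊗ xy) (w ⊗ w)`. -/
noncomputable def comulGen : Gen → Kashina k ⊗[ℂ] Kashina k
  | .w => ((1 / 2 : ℂ) • ((1 : Kashina k) ⊗ₜ[ℂ] (1 : Kashina k)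
      + (1 : Kashina k) ⊗ₜ[ℂ] (gen k .x * gen k .y)
      + gen k .z ⊗ₜ[ℂ] (1 : Kashina k)
      - gen k .z ⊗ₜ[ℂ] (gen k .x * gen k .y))) * (gen k .w ⊗ₜ[ℂ] gen k .w)
  | .x => gen k .x ⊗ₜ[ℂ] gen k .x
  | .y => gen k .y ⊗ₜ[ℂ] gen k .y
  | .z => gen k .z ⊗ₜ[ℂ] gen k .z

/-- The comultiplication, as an algebra homomorphism. -/
noncomputable def comulHom : Kashina k →ₐ[ℂ] Kashina k ⊗[ℂ] Kashina k :=
  lift k (comulGen k) (by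
    have e (g : Gen) : FreeAlgebra.lift ℂ (comulGen k) (free g) = comulGen k g :=
      FreeAlgebra.lift_ι_apply _ _
    have hw : FreeAlgebra.lift ℂ (comulGen k) (wSquare k) = wSq k ⊗ₜ[ℂ] wSq k := by
      cases k
      · simp [wSquare, wSq_two, Algebra.TensorProduct.one_def]
      · simp only [wSquare, wSq_four, e]; rfl
    intro a b h
    cases h
    case w_sq =>
      rw [map_mul, hw, e]
      simp only [comulGen, smul_mul_assoc, mul_smul_comm, add_mul, sub_mul, mul_add, mul_sub,
        Algebra.TensorProduct.tmul_mul_tmul, one_mul, mul_one, mul_assoc, smul_smul,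
        xx, yy, zz, yx, zx, zy, wx, wy, wz, ww, xx', yy', zz', yx', zx', zy', wx', wy', wz', ww']
      module
    all_goals
      simp only [map_mul, map_one, e, comulGen, smul_mul_assoc, mul_smul_comm, add_mul, sub_mul,
        mul_add, mul_sub, smul_add, smul_sub,
        Algebra.TensorProduct.tmul_mul_tmul, one_mul, mul_one, mul_assoc, smul_smul,
        xx, yy, zz, yx, zx, zy, wx, wy, wz, ww, xx', yy', zz', yx', zx', zy', wx', wy', wz', ww',
        Algebra.TensorProduct.one_def])

lemma comulHom_gen (g : Gen) : comulHom k (gen k g) = comulGen k g := lift_gen k _ _ g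

lemma counitHom_gen (g : Gen) : counitHom k (gen k g) = 1 := lift_gen k _ _ g

noncomputable instance : Bialgebra ℂ (Kashina k) :=
  Bialgebra.ofAlgHom (comulHom k) (counitHom k)
    (by
      apply hom_ext
      intro g
      cases g <;>
      simp [comulHom_gen, comulGen, TensorProduct.tmul_add, TensorProduct.add_tmul,
        TensorProduct.sub_tmul, TensorProduct.tmul_sub, add_mul, sub_mul, mul_add, mul_sub,
        ← TensorProduct.smul_tmul', TensorProduct.tmul_smul, smul_add, smul_sub, Algebra.TensorProduct.one_def, mul_assoc,
        xx, yy, zz, yx, zx, zy, wx, wy, wz, xx', yy', zz', yx', zx', zy', wx', wy', wz']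
      try module)
    (by
      apply hom_ext
      intro g
      cases g <;> simp [comulHom_gen, counitHom_gen, comulGen, add_mul, sub_mul, mul_assoc]
      try module)
    (by
      apply hom_ext
      intro g
      cases g <;> simp [comulHom_gen, counitHom_gen, comulGen, add_mul, sub_mul, mul_assoc]
      try module)

lemma comul_gen (g : Gen) : Coalgebra.comul (R := ℂ) (gen k g) = comulGen k g :=
  comulHom_gen k g

lemma counit_gen (g : Gen) : Coalgebra.counit (R := ℂ) (gen k g) = 1 :=
  counitHom_gen k g

/-- The antipode on generators: `S(w) = ½ w⁻¹ (1 + xy + z - xyz)`, where `w⁻¹ = w² w`. -/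
noncomputable def antipodeGen : Gen → Kashina k
  | .w => (1 / 2 : ℂ) • (wSq k * gen k .w *
      (1 + gen k .x * gen k .y + gen k .z - gen k .x * gen k .y * gen k .z))
  | .x => gen k .x
  | .y => gen k .y
  | .z => gen k .z

/-- The antipode, as an algebra homomorphism to the opposite algebra. -/
noncomputable def antipodeHom : Kashina k →ₐ[ℂ] (Kashina k)ᵐᵒᵖ :=
  lift k (fun g => MulOpposite.op (antipodeGen k g)) (by
    have e (g : Gen) : FreeAlgebra.lift ℂ (fun g => MulOpposite.op (antipodeGen k g)) (free g)
        = MulOpposite.op (antipodeGen k g) :=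
      FreeAlgebra.lift_ι_apply _ _
    intro a b h
    cases h <;> cases k <;>
    simp only [map_mul, map_one, wSquare, e, ← MulOpposite.op_mul, ← MulOpposite.op_one] <;>
    simp only [antipodeGen, smul_mul_assoc, mul_smul_comm, add_mul, sub_mul,
        mul_add, mul_sub, smul_add, smul_sub, wSq_two, wSq_four, one_mul, mul_one, mul_assoc,
        smul_smul,
        xx, yy, zz, yx, zx, zy, wx, wy, wz, ww, xx', yy', zz', yx', zx', zy', wx', wy', wz', ww']
    all_goals try (congr 1; module))

/-- The antipode, as a linear map. -/
noncomputable def antipodeMap : Kashina k →ₗ[ℂ] Kashina k :=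
  (MulOpposite.opLinearEquiv ℂ).symm.toLinearMap ∘ₗ (antipodeHom k).toLinearMap

lemma antipodeMap_gen (g : Gen) : antipodeMap k (gen k g) = antipodeGen k g := by
  simp [antipodeMap, antipodeHom]

lemma antipodeMap_mul (a b : Kashina k) :
    antipodeMap k (a * b) = antipodeMap k b * antipodeMap k a := by
  simp [antipodeMap]

lemma antipodeMap_algebraMap (c : ℂ) :
    antipodeMap k (algebraMap ℂ _ c) = algebraMap ℂ _ c := by
  simp [antipodeMap]

lemma antipode_left (a : Kashina k) :
    LinearMap.mul' ℂ (Kashina k) ((antipodeMap k).rTensor (Kashina k) (comulHom k a)) =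
      algebraMap ℂ _ (counitHom k a) := by
  set F : Kashina k ⊗[ℂ] Kashina k →ₗ[ℂ] Kashina k :=
    LinearMap.mul' ℂ (Kashina k) ∘ₗ (antipodeMap k).rTensor (Kashina k) with hF
  have hFt (p q : Kashina k) : F (p ⊗ₜ q) = antipodeMap k p * q := by simp [hF]
  have key (X : Kashina k ⊗[ℂ] Kashina k) (p q : Kashina k) :
      F (X * (p ⊗ₜ q)) = antipodeMap k p * F X * q := by
    induction X with
    | zero => simp
    | tmul s t => simp [hFt, antipodeMap_mul, mul_assoc]
    | add s t hs ht => simp [add_mul, mul_add, hs, ht]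
  have key2 (X Y : Kashina k ⊗[ℂ] Kashina k) (c : ℂ) (hX : F X = algebraMap ℂ _ c) :
      F (X * Y) = algebraMap ℂ _ c * F Y := by
    induction Y with
    | zero => simp
    | tmul s t =>
      rw [key, hX, hFt, ← Algebra.commutes c (antipodeMap k s), mul_assoc]
    | add s t hs ht => simp [mul_add, hs, ht]
  change F (comulHom k a) = _
  induction a using induction with
  | h0 c =>
    rw [AlgHom.commutes, AlgHom.commutes, Algebra.TensorProduct.algebraMap_apply, hFt,
      antipodeMap_algebraMap]
    simp
  | h1 g =>
    rw [comulHom_gen, counitHom_gen]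
    cases g <;> cases k <;>
    simp [comulGen, add_mul, sub_mul, hFt, antipodeMap_mul, antipodeMap_gen, antipodeGen,
      mul_add, mul_sub, wSq_two, wSq_four, mul_assoc,
      xx, yy, zz, yx, zx, zy, wx, wy, wz, ww, xx', yy', zz', yx', zx', zy', wx', wy', wz', ww']
    all_goals try module
  | hm a b ha hb => rw [map_mul, key2 _ _ _ ha, hb, map_mul, map_mul]
  | ha a b ha hb => rw [map_add, map_add, ha, hb, map_add, map_add]

lemma antipode_right (a : Kashina k) :
    LinearMap.mul' ℂ (Kashina k) ((antipodeMap k).lTensor (Kashina k) (comulHom k a)) =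
      algebraMap ℂ _ (counitHom k a) := by
  set F : Kashina k ⊗[ℂ] Kashina k →ₗ[ℂ] Kashina k :=
    LinearMap.mul' ℂ (Kashina k) ∘ₗ (antipodeMap k).lTensor (Kashina k) with hF
  have hFt (p q : Kashina k) : F (p ⊗ₜ q) = p * antipodeMap k q := by simp [hF]
  have key (X : Kashina k ⊗[ℂ] Kashina k) (p q : Kashina k) :
      F ((p ⊗ₜ q) * X) = p * F X * antipodeMap k q := by
    induction X with
    | zero => simp
    | tmul s t => simp [hFt, antipodeMap_mul, mul_assoc]
    | add s t hs ht => simp [add_mul, mul_add, hs, ht]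
  have key2 (X Y : Kashina k ⊗[ℂ] Kashina k) (c : ℂ) (hY : F Y = algebraMap ℂ _ c) :
      F (X * Y) = F X * algebraMap ℂ _ c := by
    induction X with
    | zero => simp
    | tmul s t =>
      rw [key, hY, hFt, mul_assoc, Algebra.commutes c (antipodeMap k t), mul_assoc]
    | add s t hs ht => simp [add_mul, hs, ht]
  change F (comulHom k a) = _
  induction a using induction with
  | h0 c =>
    rw [AlgHom.commutes, AlgHom.commutes, Algebra.TensorProduct.algebraMap_apply, hFt]
    have h1 := antipodeMap_algebraMap k 1
    rw [map_one] at h1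
    rw [h1, mul_one]
    rfl
  | h1 g =>
    rw [comulHom_gen, counitHom_gen]
    cases g <;> cases k <;>
    simp [comulGen, add_mul, sub_mul, hFt, antipodeMap_mul, antipodeMap_gen, antipodeGen,
      mul_add, mul_sub, wSq_two, wSq_four, mul_assoc,
      xx, yy, zz, yx, zx, zy, wx, wy, wz, ww, xx', yy', zz', yx', zx', zy', wx', wy', wz', ww']
    all_goals try module
  | hm a b ha hb => rw [map_mul, key2 _ _ _ hb, ha, map_mul, map_mul]
  | ha a b ha hb => rw [map_add, map_add, ha, hb, map_add, map_add]

/-- The Hopf algebra structure. -/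
noncomputable instance : HopfAlgebra ℂ (Kashina k) where
  antipode := antipodeMap k
  mul_antipode_rTensor_comul := LinearMap.ext (antipode_left k)
  mul_antipode_lTensor_comul := LinearMap.ext (antipode_right k)

end Kashina

/-! ### The two-dimensional representations -/

/-- Selects one of the two-dimensional representations `π₁`, `π₂`. -/
inductive PiIndex
  | one
  | two

/-- The matrices of the generators in `π₁` and `π₂` with respect to the basis `u, v`
(columns are the images of the basis vectors). -/
noncomputable def piMatrix (k : Index) (i : PiIndex) : Gen → Matrix (Fin 2) (Fin 2) ℂ
  | .x => !![1, 0; 0, -1]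
  | .y => !![-1, 0; 0, 1]
  | .z =>
    match i with
    | .one => !![1, 0; 0, 1]
    | .two => !![-1, 0; 0, -1]
  | .w =>
    match k, i with
    | .four, .two => !![0, Complex.I; Complex.I, 0]
    | _, _ => !![0, 1; 1, 0]

/-- The representation `π_i` in matrix form. -/
noncomputable def piRep (k : Index) (i : PiIndex) : Kashina k →ₐ[ℂ] Matrix (Fin 2) (Fin 2) ℂ :=
  Kashina.lift k (piMatrix k i) (by
    have e (g : Gen) : FreeAlgebra.lift ℂ (piMatrix k i) (free g) = piMatrix k i g :=
      FreeAlgebra.lift_ι_apply _ _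
    intro a b h
    cases h <;> cases k <;> cases i <;>
      simp [map_mul, wSquare, e, piMatrix, Matrix.one_fin_two])

/-! ### Ore extensions -/

/-- A copy of the ring `B` on which `Multiplicative ℕ` acts through the powers of `σ`. -/
def Twisted {B : Type*} [Ring B] [Algebra ℂ B] (_σ : B →ₐ[ℂ] B) : Type _ := B

namespace Twisted

variable {B : Type*} [Ring B] [Algebra ℂ B] (σ : B →ₐ[ℂ] B)

instance : Ring (Twisted σ) := inferInstanceAs (Ring B)

instance : Algebra ℂ (Twisted σ) := inferInstanceAs (Algebra ℂ B)

/-- The identity map from `B` to its copy. -/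
def of : B ≃ₐ[ℂ] Twisted σ := AlgEquiv.refl (A₁ := B)

instance : MulSemiringAction (Multiplicative ℕ) (Twisted σ) where
  smul n b := of σ ((σ ^ n.toAdd : B →ₐ[ℂ] B) ((of σ).symm b))
  one_smul b := rfl
  mul_smul m n b := by
    change of σ ((σ ^ (m.toAdd + n.toAdd) : B →ₐ[ℂ] B) ((of σ).symm b)) =
      of σ ((σ ^ m.toAdd : B →ₐ[ℂ] B) ((σ ^ n.toAdd : B →ₐ[ℂ] B) ((of σ).symm b)))
    rw [pow_add]; rfl
  smul_zero n := map_zero (σ ^ n.toAdd : B →ₐ[ℂ] B)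
  smul_add n := map_add (σ ^ n.toAdd : B →ₐ[ℂ] B)
  smul_one n := map_one (σ ^ n.toAdd : B →ₐ[ℂ] B)
  smul_mul n := map_mul (σ ^ n.toAdd : B →ₐ[ℂ] B)

lemma smul_of (n : Multiplicative ℕ) (b : B) :
    n • of σ b = of σ ((σ ^ n.toAdd : B →ₐ[ℂ] B) b) := rfl

instance : SMulCommClass (Multiplicative ℕ) ℂ (Twisted σ) where
  smul_comm n c b := map_smul (σ ^ n.toAdd : B →ₐ[ℂ] B) c b

end Twisted

/-- The Ore extension `B[t; σ]`: left `B`-module with basis `1, t, t², …`, and `t b = σ(b) t`. -/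
abbrev OreExtension {B : Type*} [Ring B] [Algebra ℂ B] (σ : B →ₐ[ℂ] B) : Type _ :=
  SkewPolynomial (Twisted σ)

namespace OreExtension

variable {B : Type*} [Ring B] [Algebra ℂ B] (σ : B →ₐ[ℂ] B)

/-- The element `b` of `B`, in `B[t; σ]`. -/
noncomputable def coeff (b : B) : OreExtension σ :=
  SkewPolynomial.C (Twisted.of σ b)

/-- The variable `t` of `B[t; σ]`. -/
noncomputable def t : OreExtension σ := SkewPolynomial.X

lemma t_mul_coeff (b : B) : t σ * coeff σ b = coeff σ (σ b) * t σ := by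
  rw [t, coeff, coeff, ← SkewPolynomial.monomial_zero_left, ← SkewPolynomial.monomial_zero_left,
    SkewPolynomial.X_mul_monomial, SkewPolynomial.monomial_mul_X]
  congr 1

end OreExtension

/-! ### The algebras `ℂ⟨u, v⟩/(r)[t; σ]` -/

/-- The four possible relations `r`: `u² + v²`, `u² - v²`, `uv + vu`, `uv - vu`. -/
inductive QuadRel
  | sqAdd
  | sqSub
  | mulAdd
  | mulSub

/-- The relation `r` as an element of the free algebra on `u = ι 0`, `v = ι 1`. -/
noncomputable def QuadRel.elt : QuadRel → FreeAlgebra ℂ (Fin 2)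
  | .sqAdd => FreeAlgebra.ι ℂ 0 * FreeAlgebra.ι ℂ 0 + FreeAlgebra.ι ℂ 1 * FreeAlgebra.ι ℂ 1
  | .sqSub => FreeAlgebra.ι ℂ 0 * FreeAlgebra.ι ℂ 0 - FreeAlgebra.ι ℂ 1 * FreeAlgebra.ι ℂ 1
  | .mulAdd => FreeAlgebra.ι ℂ 0 * FreeAlgebra.ι ℂ 1 + FreeAlgebra.ι ℂ 1 * FreeAlgebra.ι ℂ 0
  | .mulSub => FreeAlgebra.ι ℂ 0 * FreeAlgebra.ι ℂ 1 - FreeAlgebra.ι ℂ 1 * FreeAlgebra.ι ℂ 0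

/-- The relation `r = 0`. -/
inductive QuadAlgRel (q : QuadRel) : FreeAlgebra ℂ (Fin 2) → FreeAlgebra ℂ (Fin 2) → Prop
  | rel : QuadAlgRel q q.elt 0

/-- The algebra `ℂ⟨u, v⟩/(r)`. -/
abbrev QuadAlg (q : QuadRel) : Type := RingQuot (QuadAlgRel q)

namespace QuadAlg

/-- The generators: `gen q 0 = u` and `gen q 1 = v`. -/
noncomputable def gen (q : QuadRel) (j : Fin 2) : QuadAlg q :=
  RingQuot.mkAlgHom ℂ (QuadAlgRel q) (FreeAlgebra.ι ℂ j)

lemma mk_elt (q : QuadRel) : RingQuot.mkAlgHom ℂ (QuadAlgRel q) q.elt = 0 := by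
  rw [RingQuot.mkAlgHom_rel ℂ (QuadAlgRel.rel (q := q)), map_zero]

/-- The scalar by which `diag(α, -α)` multiplies the relation `r`. -/
def sigmaScale (q : QuadRel) (α : ℂ) : ℂ :=
  match q with
  | .sqAdd => α * α
  | .sqSub => α * α
  | .mulAdd => -(α * α)
  | .mulSub => -(α * α)

/-- The endomorphism `σ = diag(α, -α)`: `u ↦ α u`, `v ↦ -α v`. It is an automorphism if
`α ≠ 0`. -/
noncomputable def sigma (q : QuadRel) (α : ℂ) : QuadAlg q →ₐ[ℂ] QuadAlg q :=
  RingQuot.liftAlgHom ℂ ⟨FreeAlgebra.lift ℂ ![α • gen q 0, -α • gen q 1], by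
    rintro _ _ ⟨⟩
    have h : FreeAlgebra.lift ℂ ![α • gen q 0, -α • gen q 1] q.elt =
        sigmaScale q α • RingQuot.mkAlgHom ℂ (QuadAlgRel q) q.elt := by
      cases q <;>
      simp only [QuadRel.elt, sigmaScale, gen, map_add, map_sub, map_mul,
        FreeAlgebra.lift_ι_apply, Matrix.cons_val_zero, Matrix.cons_val_one, smul_mul_assoc,
        mul_smul_comm, smul_smul] <;>
      module
    rw [h, mk_elt, smul_zero, map_zero]⟩

lemma sigma_gen_zero (q : QuadRel) (α : ℂ) : sigma q α (gen q 0) = α • gen q 0 :=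
  (RingQuot.liftAlgHom_mkAlgHom_apply ℂ _ _ _).trans (FreeAlgebra.lift_ι_apply _ _)

lemma sigma_gen_one (q : QuadRel) (α : ℂ) : sigma q α (gen q 1) = -α • gen q 1 :=
  (RingQuot.liftAlgHom_mkAlgHom_apply ℂ _ _ _).trans (FreeAlgebra.lift_ι_apply _ _)

end QuadAlg

/-- The algebra `A = ℂ⟨u, v⟩/(r)[t; σ]` with `σ = diag(α, -α)`. -/
abbrev OreAlg (q : QuadRel) (α : ℂ) : Type := OreExtension (QuadAlg.sigma q α)

namespace OreAlg

variable (q : QuadRel) (α : ℂ)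

/-- The generator `u`. -/
noncomputable def u : OreAlg q α := OreExtension.coeff _ (QuadAlg.gen q 0)

/-- The generator `v`. -/
noncomputable def v : OreAlg q α := OreExtension.coeff _ (QuadAlg.gen q 1)

/-- The generator `t`. -/
noncomputable def t : OreAlg q α := OreExtension.t _

/-- The homogeneous component `A_n` of `A` (with `u`, `v`, `t` of degree one): the span of the
products of `n` generators. -/
noncomputable def degreePart (n : ℕ) : Submodule ℂ (OreAlg q α) :=
  Submodule.span ℂ {u q α, v q α, t q α} ^ n

end OreAlg

end KashinaSixteen

/-!
The proof has two parts: the construction of the action, and inner-faithfulness.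

**The action.** The grouplike elements `x`, `y`, `z` act on `A` by diagonal automorphisms. The
element `w` is not grouplike: on a product it acts by
`w.(ab) = ½ ((w.a)(w.b) + (w.a)(D(w.b)) + Z(w.a)(w.b) - Z(w.a)(D(w.b)))`, where `D` and `Z` are the
actions of `xy` and `z`. Since `D` and `Z` are commuting involutions, the right-hand side is an
associative product `twistedMul D Z` of `w.a` and `w.b` (`twistedMul_assoc`). Hence
`b ↦ (a ↦ twistedMul D Z a (w.b))` has to be an algebra homomorphism `A → (End A)ᵒᵖ`. Its values
on the generators are explicit and satisfy the relations `r = 0`, `tu = α ut`,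
`tv = -α vt`, so the universal property of `A` (`OreAlg.lift`) provides it; evaluation at `1` gives
the operator `opW`. The relations of `H` between these operators hold because both sides of each
are multiplicative, or twisted multiplicative in the same way, and agree on `u`, `v`, `t`.

**Inner-faithfulness.** A Hopf ideal `I` that annihilates `A` annihilates `π_i` and `χ`, as `u`, `v`,
`t` are linearly independent. Being a coideal, it also annihilates `π_i ⊗ π_i`, and it is stable
under the winding endomorphism `h ↦ ∑ h₁ χ(h₂)`. For each idempotent `e` of the group algebra of
`⟨x, y, z⟩`, the space `eH` is spanned by `e` and `ew` (`idem_mul_mem`). Half of the eight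
idempotents are seen by `π_i` (those with `xy = -1`, `z = ±1` as in `π_i`) and by `π_i ⊗ π_i` (those
with `xy = 1`, `z = 1`): matrix entries there show that `e` and `ew` are independent modulo `I`.
The winding endomorphism changes the sign of `z` and carries the result to the other half
(`Kashina.separates`). So `eI = 0` for all `e`, and `I = 0`.
-/

namespace KashinaSixteen

/-! ### The universal property of the Ore extension `ℂ⟨u, v⟩/(r)[t; σ]` -/

namespace QuadAlg

lemma induction {q : QuadRel} {P : QuadAlg q → Prop} (h0 : ∀ c : ℂ, P (algebraMap ℂ _ c))
    (h1 : ∀ j, P (gen q j)) (hm : ∀ a b, P a → P b → P (a * b))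
    (ha : ∀ a b, P a → P b → P (a + b)) (a : QuadAlg q) : P a := by
  obtain ⟨a, rfl⟩ := RingQuot.mkAlgHom_surjective ℂ (QuadAlgRel q) a
  induction a using FreeAlgebra.induction with
  | grade0 r => rw [AlgHom.commutes]; exact h0 r
  | grade1 g => exact h1 g
  | mul a b h1 h2 => rw [map_mul]; exact hm _ _ h1 h2
  | add a b h1 h2 => rw [map_add]; exact ha _ _ h1 h2

/-- The universal property of `ℂ⟨u, v⟩/(r)`. -/
noncomputable def lift {q : QuadRel} {C : Type*} [Ring C] [Algebra ℂ C] (p : Fin 2 → C)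
    (hr : FreeAlgebra.lift ℂ p q.elt = 0) : QuadAlg q →ₐ[ℂ] C :=
  RingQuot.liftAlgHom ℂ ⟨FreeAlgebra.lift ℂ p, by rintro _ _ ⟨⟩; rw [hr, map_zero]⟩

@[simp] lemma lift_gen {q : QuadRel} {C : Type*} [Ring C] [Algebra ℂ C] (p : Fin 2 → C)
    (hr : FreeAlgebra.lift ℂ p q.elt = 0) (j : Fin 2) : lift p hr (gen q j) = p j :=
  (RingQuot.liftAlgHom_mkAlgHom_apply ℂ _ _ _).trans (FreeAlgebra.lift_ι_apply _ _)

end QuadAlg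

namespace OreAlg

variable {q : QuadRel} {α : ℂ}

section lift

variable {C : Type*} [Ring C] [Algebra ℂ C]

/-- The relation `s b = σ(b) s` follows from its instances `b = u`, `b = v`. -/
lemma lift_sigma_mul (f : QuadAlg q →ₐ[ℂ] C) (s : C)
    (h0 : s * f (QuadAlg.gen q 0) = α • (f (QuadAlg.gen q 0) * s))
    (h1 : s * f (QuadAlg.gen q 1) = -α • (f (QuadAlg.gen q 1) * s)) (b : QuadAlg q) :
    f (QuadAlg.sigma q α b) * s = s * f b := by
  induction b using QuadAlg.induction with
  | h0 c => rw [AlgHom.commutes, AlgHom.commutes, Algebra.commutes]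
  | h1 j =>
    fin_cases j
    · simp [QuadAlg.sigma_gen_zero, h0]
    · simp [QuadAlg.sigma_gen_one, h1]
  | hm a b ha hb => rw [map_mul, map_mul, mul_assoc, hb, ← mul_assoc, ha, map_mul, mul_assoc]
  | ha a b ha hb => rw [map_add, map_add, add_mul, ha, hb, map_add, mul_add]

/-- The universal property of `A`: an algebra homomorphism out of `A` is given by images of `u`,
`v` and `t` that satisfy `r = 0`, `tu = α ut` and `tv = -α vt`. -/
noncomputable def lift (p : Fin 2 → C) (s : C) (hr : FreeAlgebra.lift ℂ p q.elt = 0)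
    (h0 : s * p 0 = α • (p 0 * s)) (h1 : s * p 1 = -α • (p 1 * s)) : OreAlg q α →ₐ[ℂ] C :=
  SkewMonoidAlgebra.liftNCAlgHom
    ((QuadAlg.lift p hr).comp (Twisted.of (QuadAlg.sigma q α)).symm.toAlgHom)
    (powersHom C s) (by
      intro b n
      obtain ⟨b, rfl⟩ := (Twisted.of (QuadAlg.sigma q α)).surjective b
      have key (m : ℕ) (b : QuadAlg q) :
          QuadAlg.lift p hr ((QuadAlg.sigma q α ^ m : QuadAlg q →ₐ[ℂ] QuadAlg q) b) * s ^ m =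
            s ^ m * QuadAlg.lift p hr b := by
        induction m generalizing b with
        | zero => simp
        | succ m ih =>
          rw [pow_succ (QuadAlg.sigma q α), pow_succ s, AlgHom.mul_apply, ← mul_assoc, ih,
            mul_assoc, lift_sigma_mul _ s (by simpa using h0) (by simpa using h1), mul_assoc]
      exact key n.toAdd b)

variable (p : Fin 2 → C) (s : C) (hr : FreeAlgebra.lift ℂ p q.elt = 0)
    (h0 : s * p 0 = α • (p 0 * s)) (h1 : s * p 1 = -α • (p 1 * s))

lemma lift_single (n : Multiplicative ℕ) (b : QuadAlg q) :
    lift p s hr h0 h1 (SkewMonoidAlgebra.single n (Twisted.of (QuadAlg.sigma q α) b)) =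
      QuadAlg.lift p hr b * s ^ n.toAdd :=
  SkewMonoidAlgebra.liftNC_single _ _ _ _

@[simp] lemma lift_u : lift p s hr h0 h1 (u q α) = p 0 :=
  (lift_single p s hr h0 h1 1 _).trans (by simp)

@[simp] lemma lift_v : lift p s hr h0 h1 (v q α) = p 1 :=
  (lift_single p s hr h0 h1 1 _).trans (by simp)

@[simp] lemma lift_t : lift p s hr h0 h1 (t q α) = s :=
  (lift_single p s hr h0 h1 (Multiplicative.ofAdd 1) 1).trans (by simp)

end lift

/-- The inclusion of `ℂ⟨u, v⟩/(r)` in `A`. -/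
noncomputable def coeffHom : QuadAlg q →ₐ[ℂ] OreAlg q α where
  toFun := OreExtension.coeff _
  map_one' := rfl
  map_mul' a b := by
    rw [OreExtension.coeff, OreExtension.coeff, OreExtension.coeff, map_mul,
      SkewPolynomial.C_mul]
  map_zero' := SkewPolynomial.C_0
  map_add' a b := by
    rw [OreExtension.coeff, OreExtension.coeff, OreExtension.coeff, map_add,
      SkewPolynomial.C_add]
  commutes' _ := rfl

lemma coeffHom_gen_zero : coeffHom (QuadAlg.gen q 0) = u q α := rfl

lemma coeffHom_gen_one : coeffHom (QuadAlg.gen q 1) = v q α := rfl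

/-- `A` is generated by `u`, `v` and `t`. -/
lemma induction {P : OreAlg q α → Prop} (h0 : ∀ c : ℂ, P (algebraMap ℂ _ c))
    (hu : P (u q α)) (hv : P (v q α)) (ht : P (t q α)) (hm : ∀ a b, P a → P b → P (a * b))
    (ha : ∀ a b, P a → P b → P (a + b)) (a : OreAlg q α) : P a := by
  have hc (b : QuadAlg q) : P (coeffHom b) := by
    induction b using QuadAlg.induction with
    | h0 c => rw [AlgHom.commutes]; exact h0 c
    | h1 j =>
      fin_cases j
      · exact hu
      · exact hv
    | hm a b ha hb => rw [map_mul]; exact hm _ _ ha hb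
    | ha a b h1 h2 => rw [map_add]; exact ha _ _ h1 h2
  have htn (n : ℕ) : P (t q α ^ n) := by
    induction n with
    | zero => rw [pow_zero, ← map_one (algebraMap ℂ _)]; exact h0 1
    | succ n ih => rw [pow_succ]; exact hm _ _ ih ht
  induction a using SkewPolynomial.induction with
  | h0 => rw [← map_zero (algebraMap ℂ _)]; exact h0 0
  | ha n r p _ _ hp =>
    refine ha _ _ ?_ hp
    rw [← SkewPolynomial.C_mul_X_pow_eq_monomial]
    exact hm _ _ (hc r) (htn n)

lemma algHom_ext {C : Type*} [Ring C] [Algebra ℂ C] {f g : OreAlg q α →ₐ[ℂ] C}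
    (hu : f (u q α) = g (u q α)) (hv : f (v q α) = g (v q α)) (ht : f (t q α) = g (t q α)) :
    f = g := by
  ext a
  induction a using OreAlg.induction with
  | h0 c => rw [AlgHom.commutes, AlgHom.commutes]
  | hu => exact hu
  | hv => exact hv
  | ht => exact ht
  | hm a b ha hb => rw [map_mul, map_mul, ha, hb]
  | ha a b ha hb => rw [map_add, map_add, ha, hb]

lemma t_mul_coeffHom (b : QuadAlg q) :
    t q α * coeffHom b = coeffHom (QuadAlg.sigma q α b) * t q α :=
  OreExtension.t_mul_coeff _ b

lemma t_mul_u : t q α * u q α = α • (u q α * t q α) := by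
  rw [← coeffHom_gen_zero, t_mul_coeffHom, QuadAlg.sigma_gen_zero, map_smul, smul_mul_assoc]

lemma t_mul_v : t q α * v q α = -α • (v q α * t q α) := by
  rw [← coeffHom_gen_one, t_mul_coeffHom, QuadAlg.sigma_gen_one, map_smul, smul_mul_assoc]

/-- The relation `r = 0`, in `A`. -/
lemma lift_elt : FreeAlgebra.lift ℂ ![u q α, v q α] q.elt = 0 := by
  have h : FreeAlgebra.lift ℂ ![u q α, v q α] =
      coeffHom.comp (RingQuot.mkAlgHom ℂ (QuadAlgRel q)) := by
    apply FreeAlgebra.hom_ext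
    funext j
    fin_cases j
    · exact FreeAlgebra.lift_ι_apply _ _
    · exact FreeAlgebra.lift_ι_apply _ _
  rw [h, AlgHom.comp_apply, QuadAlg.mk_elt, map_zero]

/-- `A` maps onto the trivial extension `ℂ ⊕ ℂ³` in which all products of generators vanish, and
`u`, `v`, `t` go to the standard basis of `ℂ³`. -/
lemma linearIndependent_generators : LinearIndependent ℂ ![u q α, v q α, t q α] := by
  let e (j : Fin 3) : TrivSqZeroExt ℂ (Fin 3 → ℂ) := TrivSqZeroExt.inr (Pi.single j 1)
  have he (i j : Fin 3) : e i * e j = 0 := TrivSqZeroExt.inr_mul_inr ..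
  let f : OreAlg q α →ₐ[ℂ] TrivSqZeroExt ℂ (Fin 3 → ℂ) :=
    lift ![e 0, e 1] (e 2) (by cases q <;> simp [QuadRel.elt, he]) (by simp [he]) (by simp [he])
  refine LinearIndependent.of_comp ((TrivSqZeroExt.sndHom ℂ (Fin 3 → ℂ)).comp f.toLinearMap) ?_
  convert Pi.linearIndependent_single_one (Fin 3) ℂ using 1
  funext j
  fin_cases j <;> simp [f, e]

end OreAlg

/-! ### Twisted multiplicative maps -/

section TwistedMultiplicative

variable {A : Type*} [Ring A] [Algebra ℂ A]

/-- The product `½ (ab + a D(b) + Z(a) b - Z(a) D(b))` through which `w` acts on products. If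
`D(b) = b`, it is `ab`, and if `D(b) = -b`, it is `Z(a) b`. -/
noncomputable def twistedMul (D Z : A →ₐ[ℂ] A) (a b : A) : A :=
  (1 / 2 : ℂ) • (a * b + a * D b + Z a * b - Z a * D b)

lemma twistedMul_assoc {D Z : A →ₐ[ℂ] A} (hD : ∀ a, D (D a) = a) (hZ : ∀ a, Z (Z a) = a)
    (hDZ : ∀ a, D (Z a) = Z (D a)) (a b c : A) :
    twistedMul D Z (twistedMul D Z a b) c = twistedMul D Z a (twistedMul D Z b c) := by
  simp only [twistedMul, map_smul, map_add, map_sub, map_mul, hD, hZ, hDZ, smul_mul_assoc,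
    mul_smul_comm, add_mul, sub_mul, mul_add, mul_sub, mul_assoc]
  module

lemma map_twistedMul {D Z F : A →ₐ[ℂ] A} (hD : ∀ a, F (D a) = D (F a))
    (hZ : ∀ a, F (Z a) = Z (F a)) (a b : A) :
    F (twistedMul D Z a b) = twistedMul D Z (F a) (F b) := by
  simp only [twistedMul, map_smul, map_add, map_sub, map_mul, hD, hZ]

/-- The square of a twisted multiplicative map is multiplicative. -/
lemma sq_mul_of_twisted {D Z : A →ₐ[ℂ] A} (hD : ∀ a, D (D a) = a) (hZ : ∀ a, Z (Z a) = a)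
    {W : A →ₗ[ℂ] A} (hW : ∀ a b, W (a * b) = twistedMul D Z (W a) (W b))
    (hWD : ∀ a, W (D a) = D (W a)) (hWZ : ∀ a, W (Z a) = Z (W a)) (a b : A) :
    W (W (a * b)) = W (W a) * W (W b) := by
  simp only [hW, twistedMul, map_smul, map_add, map_sub, hWD, hWZ, hD, hZ]
  module

end TwistedMultiplicative

/-! ### The operators through which the generators act -/

namespace OreAlg

variable {q : QuadRel} {α : ℂ}

/-- The automorphism `u ↦ a u`, `v ↦ b v`, `t ↦ c t`, for signs `a` and `b`. -/
noncomputable def diag (a b c : ℂ) (ha : a * a = 1) (hb : b * b = 1) :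
    OreAlg q α →ₐ[ℂ] OreAlg q α :=
  lift ![a • u q α, b • v q α] (c • t q α)
    (by
      have h := lift_elt (q := q) (α := α)
      cases q <;>
      simp only [QuadRel.elt, map_add, map_sub, map_mul, FreeAlgebra.lift_ι_apply,
        Matrix.cons_val_zero, Matrix.cons_val_one, smul_mul_assoc, mul_smul_comm, smul_smul,
        ha, hb, one_smul, mul_comm b a, ← smul_add, ← smul_sub] at h ⊢ <;>
      simp only [h, smul_zero])
    (by
      simp only [Matrix.cons_val_zero, smul_mul_assoc, mul_smul_comm, t_mul_u, smul_smul]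
      congr 1; ring)
    (by
      simp only [Matrix.cons_val_one, Matrix.cons_val_zero, smul_mul_assoc, mul_smul_comm,
        t_mul_v, smul_smul]
      congr 1; ring)

section diag

variable (a b c : ℂ) (ha : a * a = 1) (hb : b * b = 1)

@[simp] lemma diag_u : diag a b c ha hb (u q α) = a • u q α := lift_u ..

@[simp] lemma diag_v : diag a b c ha hb (v q α) = b • v q α := lift_v ..

@[simp] lemma diag_t : diag a b c ha hb (t q α) = c • t q α := lift_t ..

variable {a b c} {a' b' c' : ℂ} (ha' : a' * a' = 1) (hb' : b' * b' = 1)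

lemma diag_comm (x : OreAlg q α) : diag a b c ha hb (diag a' b' c' ha' hb' x) =
    diag a' b' c' ha' hb' (diag a b c ha hb x) := by
  refine DFunLike.congr_fun (f := (diag a b c ha hb).comp (diag a' b' c' ha' hb'))
    (g := (diag a' b' c' ha' hb').comp (diag a b c ha hb)) (algHom_ext ?_ ?_ ?_) x <;>
  simp [smul_smul, mul_comm]

lemma diag_diag (hc : c * c = 1) (x : OreAlg q α) :
    diag a b c ha hb (diag a b c ha hb x) = x := by
  refine DFunLike.congr_fun (f := (diag a b c ha hb).comp (diag a b c ha hb))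
    (g := AlgHom.id ℂ _) (algHom_ext ?_ ?_ ?_) x <;>
  simp [smul_smul, *]

end diag

/-- The action of `x`, where `ξ` is the scalar by which `x` and `y` act on `t`. -/
noncomputable def opX (ξ : ℂ) : OreAlg q α →ₐ[ℂ] OreAlg q α :=
  diag 1 (-1) ξ (by ring) (by ring)

/-- The action of `y`. -/
noncomputable def opY (ξ : ℂ) : OreAlg q α →ₐ[ℂ] OreAlg q α :=
  diag (-1) 1 ξ (by ring) (by ring)

/-- The action of `z`, where `s` is the scalar by which `z` acts on `u` and `v`. -/
noncomputable def opZ (s : ℂ) (hs : s * s = 1) : OreAlg q α →ₐ[ℂ] OreAlg q α :=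
  diag s s (-1) hs hs

/-- The action of `xy`. -/
noncomputable def opD : OreAlg q α →ₐ[ℂ] OreAlg q α :=
  diag (-1) (-1) 1 (by ring) (by ring)

lemma opX_opY {ξ : ℂ} (hξ : ξ * ξ = 1) (a : OreAlg q α) : opX ξ (opY ξ a) = opD a := by
  refine DFunLike.congr_fun (f := (opX ξ).comp (opY ξ)) (algHom_ext ?_ ?_ ?_) a <;>
  simp [opX, opY, opD, smul_smul, hξ]

section opW

variable {s : ℂ} (hs : s * s = 1) (c ω : ℂ)

/-- The algebra homomorphism from `A` to `(End A)ᵒᵖ` that attaches to `b` the map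
`a ↦ twistedMul opD opZ a (w.b)`. On the generators it is explicit: `u ↦ (a ↦ Z(a) cv)`,
`v ↦ (a ↦ Z(a) cu)` and `t ↦ (a ↦ a ωt)`. -/
noncomputable def twistedRight : OreAlg q α →ₐ[ℂ] (Module.End ℂ (OreAlg q α))ᵐᵒᵖ :=
  lift
    ![MulOpposite.op (LinearMap.mulRight ℂ (c • v q α) ∘ₗ (opZ s hs).toLinearMap),
      MulOpposite.op (LinearMap.mulRight ℂ (c • u q α) ∘ₗ (opZ s hs).toLinearMap)]
    (MulOpposite.op (LinearMap.mulRight ℂ (ω • t q α)))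
    (by
      have h := lift_elt (q := q) (α := α)
      refine MulOpposite.unop_injective (LinearMap.ext fun a => ?_)
      have hz : opZ s hs (opZ s hs a) = a := diag_diag hs hs (by ring) a
      cases q <;>
      simp only [QuadRel.elt, map_add, map_sub, map_mul, FreeAlgebra.lift_ι_apply,
        Matrix.cons_val_zero, Matrix.cons_val_one, MulOpposite.unop_add, MulOpposite.unop_sub,
        MulOpposite.unop_mul, MulOpposite.unop_op, LinearMap.add_apply, LinearMap.sub_apply,
        Module.End.mul_apply, LinearMap.comp_apply, LinearMap.mulRight_apply, map_smul,
        AlgHom.toLinearMap_apply, hz, MulOpposite.unop_zero, LinearMap.zero_apply] at h ⊢ <;>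
      simp only [opZ, diag_u, diag_v, mul_smul_comm, smul_mul_assoc, smul_smul, ← smul_add,
        ← smul_sub, mul_assoc, ← mul_add, ← mul_sub]
      · rw [add_comm] at h; simp [h]
      · rw [← neg_sub] at h; simp [neg_eq_zero.mp h]
      · rw [add_comm] at h; simp [h]
      · rw [← neg_sub] at h; simp [neg_eq_zero.mp h])
    (by
      refine MulOpposite.unop_injective (LinearMap.ext fun a => ?_)
      simp [opZ, smul_smul, mul_assoc, t_mul_v]
      congr 1; ring)
    (by
      refine MulOpposite.unop_injective (LinearMap.ext fun a => ?_)
      simp [opZ, smul_smul, mul_assoc, t_mul_u]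
      congr 1; ring)

/-- The action of `w`: the twisted multiplicative map `u ↦ cv`, `v ↦ cu`, `t ↦ ωt`. -/
noncomputable def opW : OreAlg q α →ₗ[ℂ] OreAlg q α :=
  LinearMap.applyₗ (1 : OreAlg q α) ∘ₗ (MulOpposite.opLinearEquiv ℂ).symm.toLinearMap ∘ₗ
    (twistedRight hs c ω).toLinearMap

lemma opW_eq (b : OreAlg q α) : opW hs c ω b = (twistedRight hs c ω b).unop 1 := rfl

@[simp] lemma opW_u : opW hs c ω (u q α) = c • v q α := by
  simp [opW_eq, twistedRight]

@[simp] lemma opW_v : opW hs c ω (v q α) = c • u q α := by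
  simp [opW_eq, twistedRight]

@[simp] lemma opW_t : opW hs c ω (t q α) = ω • t q α := by
  simp [opW_eq, twistedRight]

@[simp] lemma opW_algebraMap (r : ℂ) :
    opW hs c ω (algebraMap ℂ (OreAlg q α) r) = algebraMap ℂ _ r := by
  rw [opW_eq, AlgHom.commutes, MulOpposite.algebraMap_apply, MulOpposite.unop_op,
    Module.algebraMap_end_apply, Algebra.algebraMap_eq_smul_one]

lemma opD_opZ (a : OreAlg q α) : opD (opZ s hs a) = opZ s hs (opD a) := diag_comm ..

lemma opZ_opZ (a : OreAlg q α) : opZ s hs (opZ s hs a) = a := diag_diag hs hs (by ring) a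

lemma opD_opD (a : OreAlg q α) : opD (opD a) = a := diag_diag _ _ (by ring) a

lemma twistedRight_apply (a b : OreAlg q α) :
    (twistedRight hs c ω b).unop a = twistedMul opD (opZ s hs) a (opW hs c ω b) := by
  induction b using OreAlg.induction generalizing a with
  | h0 r =>
    rw [opW_algebraMap, AlgHom.commutes, MulOpposite.algebraMap_apply, MulOpposite.unop_op,
      Module.algebraMap_end_apply, twistedMul, AlgHom.commutes, Algebra.algebraMap_eq_smul_one]
    simp only [mul_smul_comm, mul_one]
    module
  | hu =>
    rw [opW_u, twistedMul]
    simp [twistedRight, opD]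
    module
  | hv =>
    rw [opW_v, twistedMul]
    simp [twistedRight, opD]
    module
  | ht =>
    rw [opW_t, twistedMul]
    simp [twistedRight, opD]
    module
  | hm b b' hb hb' =>
    rw [opW_eq, map_mul, MulOpposite.unop_mul, Module.End.mul_apply, Module.End.mul_apply, hb,
      hb', hb', twistedMul_assoc opD_opD (opZ_opZ hs) (opD_opZ hs), ← opW_eq]
  | ha b b' hb hb' =>
    rw [map_add, map_add, MulOpposite.unop_add, LinearMap.add_apply, hb, hb']
    simp only [twistedMul, map_add, mul_add]
    module

lemma opW_mul (a b : OreAlg q α) :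
    opW hs c ω (a * b) = twistedMul opD (opZ s hs) (opW hs c ω a) (opW hs c ω b) := by
  rw [opW_eq, map_mul, MulOpposite.unop_mul, Module.End.mul_apply, twistedRight_apply, ← opW_eq]

/-- An intertwining relation between `w` and diagonal automorphisms holds on `A` if it holds on
the generators. -/
lemma opW_intertwine {F G : OreAlg q α →ₐ[ℂ] OreAlg q α} (hD : ∀ a, G (opD a) = opD (G a))
    (hZ : ∀ a, G (opZ s hs a) = opZ s hs (G a))
    (hu : opW hs c ω (F (u q α)) = G (opW hs c ω (u q α)))
    (hv : opW hs c ω (F (v q α)) = G (opW hs c ω (v q α)))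
    (ht : opW hs c ω (F (t q α)) = G (opW hs c ω (t q α))) (a : OreAlg q α) :
    opW hs c ω (F a) = G (opW hs c ω a) := by
  induction a using OreAlg.induction with
  | h0 r => rw [AlgHom.commutes, opW_algebraMap, AlgHom.commutes]
  | hu => exact hu
  | hv => exact hv
  | ht => exact ht
  | hm a b ha hb => rw [map_mul, opW_mul, ha, hb, opW_mul, map_twistedMul hD hZ]
  | ha a b ha hb => simp only [map_add, ha, hb]

lemma opW_opX (ξ : ℂ) (a : OreAlg q α) : opW hs c ω (opX ξ a) = opY ξ (opW hs c ω a) := by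
  refine opW_intertwine hs c ω (fun _ => diag_comm ..) (fun _ => diag_comm ..) ?_ ?_ ?_ a <;>
  simp [opX, opY, smul_smul, mul_comm]

lemma opW_opY (ξ : ℂ) (a : OreAlg q α) : opW hs c ω (opY ξ a) = opX ξ (opW hs c ω a) := by
  refine opW_intertwine hs c ω (fun _ => diag_comm ..) (fun _ => diag_comm ..) ?_ ?_ ?_ a <;>
  simp [opX, opY, smul_smul, mul_comm]

lemma opW_opZ (a : OreAlg q α) : opW hs c ω (opZ s hs a) = opZ s hs (opW hs c ω a) := by
  refine opW_intertwine hs c ω (fun _ => diag_comm ..) (fun _ => diag_comm ..) ?_ ?_ ?_ a <;>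
  simp [opZ, smul_smul, mul_comm]

lemma opW_opD (a : OreAlg q α) : opW hs c ω (opD a) = opD (opW hs c ω a) := by
  refine opW_intertwine hs c ω (fun _ => diag_comm ..) (fun _ => diag_comm ..) ?_ ?_ ?_ a <;>
  simp [opD, smul_smul, mul_comm]

lemma opW_opW {F : OreAlg q α →ₐ[ℂ] OreAlg q α} (hu : F (u q α) = (c * c) • u q α)
    (hv : F (v q α) = (c * c) • v q α) (ht : F (t q α) = (ω * ω) • t q α) (a : OreAlg q α) :
    opW hs c ω (opW hs c ω a) = F a := by
  induction a using OreAlg.induction with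
  | h0 r => simp only [opW_algebraMap, AlgHom.commutes]
  | hu => simp [hu, smul_smul]
  | hv => simp [hv, smul_smul]
  | ht => simp [ht, smul_smul]
  | hm a b ha hb =>
    rw [sq_mul_of_twisted opD_opD (opZ_opZ hs) (opW_mul hs c ω) (opW_opD hs c ω)
      (opW_opZ hs c ω), ha, hb, map_mul]
  | ha a b ha hb => simp only [map_add, ha, hb]

end opW

end OreAlg

/-! ### The module algebra structure -/

section ModuleAlgebra

variable {H : Type*} [Ring H] [HopfAlgebra ℂ H] {A : Type*} [Ring A] [Algebra ℂ A]

/-- The compatibility of the action of `h` with the product of `A`, as an identity of maps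
`A ⊗ A → A`. In this form it is visibly closed under products in `h`, since both sides are built
from algebra homomorphisms out of `H`. -/
lemma compat_iff (ρ : H →ₐ[ℂ] Module.End ℂ A) (h : H) :
    (∀ a b : A, ρ h (a * b) = LinearMap.mul' ℂ A
      (TensorProduct.map (ρ.toLinearMap.flip a) (ρ.toLinearMap.flip b)
        (Coalgebra.comul (R := ℂ) h))) ↔
    ρ h ∘ₗ LinearMap.mul' ℂ A = LinearMap.mul' ℂ A ∘ₗ
      Module.endTensorEndAlgHom (R := ℂ) (S := ℂ) (A := ℂ) (Algebra.TensorProduct.map ρ ρ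
        (Bialgebra.comulAlgHom ℂ H h)) := by
  have key (X : H ⊗[ℂ] H) (a b : A) :
      TensorProduct.map (ρ.toLinearMap.flip a) (ρ.toLinearMap.flip b) X =
        Module.endTensorEndAlgHom (R := ℂ) (S := ℂ) (A := ℂ)
          (Algebra.TensorProduct.map ρ ρ X) (a ⊗ₜ b) := by
    induction X with
    | zero => simp
    | tmul x y => simp [Module.endTensorEndAlgHom_apply]
    | add x y hx hy => simp only [map_add, hx, hy, LinearMap.add_apply]
  constructor
  · intro H
    refine TensorProduct.ext' fun a b => ?_
    simp only [LinearMap.comp_apply, LinearMap.mul'_apply, H, key]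
    rfl
  · intro H a b
    have := LinearMap.congr_fun H (a ⊗ₜ b)
    simp only [LinearMap.comp_apply, LinearMap.mul'_apply] at this
    rw [this, key]
    rfl

/-- The action on `A` preserves the powers of a subspace that it preserves. -/
lemma IsModuleAlgebra.map_mem_pow {ρ : H →ₐ[ℂ] Module.End ℂ A} (hρ : IsModuleAlgebra ρ)
    {V : Submodule ℂ A} (hV : ∀ h, ∀ a ∈ V, ρ h a ∈ V) (n : ℕ) :
    ∀ h, ∀ a ∈ V ^ n, ρ h a ∈ V ^ n := by
  induction n with
  | zero =>
    intro h a ha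
    rw [pow_zero] at ha ⊢
    obtain ⟨c, rfl⟩ := Submodule.mem_one.mp ha
    rw [Algebra.algebraMap_eq_smul_one, map_smul, hρ.1]
    exact Submodule.smul_mem _ _ (Submodule.smul_mem _ _ (Submodule.one_le.mp le_rfl))
  | succ n ih =>
    intro h a ha
    rw [pow_succ] at ha ⊢
    induction ha using Submodule.mul_induction_on' with
    | mem_mul_mem a ha b hb =>
      rw [hρ.2]
      generalize (Coalgebra.comul (R := ℂ) h) = X
      induction X with
      | zero => simp
      | tmul x y => exact Submodule.mul_mem_mul (ih x a ha) (hV y b hb)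
      | add x y hx hy => rw [map_add, map_add]; exact add_mem hx hy
    | add a _ b _ ha hb => rw [map_add]; exact add_mem ha hb

end ModuleAlgebra

/-! ### The action of `H` on `A` -/

/-- The scalar by which `z` acts in `π_i`. -/
def piSign : PiIndex → ℂ
  | .one => 1
  | .two => -1

/-- The scalar `c_i` of `π_i(w)`. -/
noncomputable def piScalar : Index → PiIndex → ℂ
  | .four, .two => Complex.I
  | _, _ => 1

lemma piSign_mul_self (i : PiIndex) : piSign i * piSign i = 1 := by
  cases i <;> simp [piSign]

lemma piScalar_ne_zero (k : Index) (i : PiIndex) : piScalar k i ≠ 0 := by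
  cases k <;> cases i <;> simp [piScalar]

lemma piMatrix_z (k : Index) (i : PiIndex) :
    piMatrix k i .z = !![piSign i, 0; 0, piSign i] := by
  cases i <;> rfl

lemma piMatrix_w (k : Index) (i : PiIndex) :
    piMatrix k i .w = !![0, piScalar k i; piScalar k i, 0] := by
  cases k <;> cases i <;> rfl

lemma piRep_gen (k : Index) (i : PiIndex) (g : Gen) :
    piRep k i (Kashina.gen k g) = piMatrix k i g :=
  Kashina.lift_gen ..

section Character

variable {k : Index} (χ : Kashina k →ₐ[ℂ] ℂ)

lemma character_x_mul_self : χ (Kashina.gen k .x) * χ (Kashina.gen k .x) = 1 := by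
  rw [← map_mul, Kashina.xx, map_one]

lemma character_w_mul_self : χ (Kashina.gen k .w) * χ (Kashina.gen k .w) = χ (Kashina.wSq k) := by
  rw [← map_mul, Kashina.ww]

lemma character_w_ne_zero : χ (Kashina.gen k .w) ≠ 0 := by
  intro h
  have h1 := congrArg χ (Kashina.wSq_sq (k := k))
  rw [map_mul, ← character_w_mul_self, h, map_one] at h1
  simp at h1

lemma character_y : χ (Kashina.gen k .y) = χ (Kashina.gen k .x) := by
  have h := congrArg χ (Kashina.wx (k := k))
  rw [map_mul, map_mul, mul_comm] at h
  exact (mul_right_cancel₀ (character_w_ne_zero χ) h).symm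

end Character

section Action

open OreAlg

variable {k : Index} (i : PiIndex) (χ : Kashina k →ₐ[ℂ] ℂ) (q : QuadRel) (α : ℂ)

/-- The operators on `A` through which the generators of `H` act. -/
noncomputable def actionGen : Gen → Module.End ℂ (OreAlg q α)
  | .x => (opX (χ (Kashina.gen k .x))).toLinearMap
  | .y => (opY (χ (Kashina.gen k .x))).toLinearMap
  | .z => (opZ (piSign i) (piSign_mul_self i)).toLinearMap
  | .w => opW (piSign_mul_self i) (piScalar k i) (χ (Kashina.gen k .w))

lemma actionGen_rel (hχ : χ (Kashina.gen k .z) = -1) ⦃a b : FreeAlgebra ℂ Gen⦄ (h : Rel k a b) :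
    FreeAlgebra.lift ℂ (actionGen i χ q α) a = FreeAlgebra.lift ℂ (actionGen i χ q α) b := by
  have e (g : Gen) : FreeAlgebra.lift ℂ (actionGen i χ q α) (free g) = actionGen i χ q α g :=
    FreeAlgebra.lift_ι_apply _ _
  have hx := character_x_mul_self χ
  have hw := character_w_mul_self χ
  cases h <;> refine LinearMap.ext fun a => ?_ <;>
    simp only [map_mul, map_one, e, Module.End.mul_apply, Module.End.one_apply]
  case x_sq => exact diag_diag (by ring) (by ring) hx a
  case y_sq => exact diag_diag (by ring) (by ring) hx a
  case z_sq => exact opZ_opZ (piSign_mul_self i) a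
  case y_x => exact diag_comm (by ring) (by ring) (by ring) (by ring) a
  case z_x =>
    exact diag_comm (piSign_mul_self i) (piSign_mul_self i) (by ring) (by ring) a
  case z_y =>
    exact diag_comm (piSign_mul_self i) (piSign_mul_self i) (by ring) (by ring) a
  case w_x => exact opW_opX ..
  case w_y => exact opW_opY ..
  case w_z => exact opW_opZ ..
  case w_sq =>
    cases k
    · rw [Kashina.wSq_two, map_one] at hw
      rw [wSquare, map_one]
      refine opW_opW _ _ _ (F := AlgHom.id ℂ _) ?_ ?_ ?_ a <;> simp [piScalar, hw]
    · rw [Kashina.wSq_four, hχ] at hw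
      rw [wSquare, e]
      refine opW_opW _ _ _ (F := opZ (piSign i) (piSign_mul_self i)) ?_ ?_ ?_ a <;>
        cases i <;> simp [opZ, piScalar, piSign, hw]

variable (hχ : χ (Kashina.gen k .z) = -1)

/-- The action of `H` on `A`. -/
noncomputable def action : Kashina k →ₐ[ℂ] Module.End ℂ (OreAlg q α) :=
  Kashina.lift k (actionGen i χ q α) (actionGen_rel i χ q α hχ)

lemma action_gen (g : Gen) : action i χ q α hχ (Kashina.gen k g) = actionGen i χ q α g :=
  Kashina.lift_gen ..

lemma action_one (h : Kashina k) :
    action i χ q α hχ h 1 = Coalgebra.counit (R := ℂ) h • (1 : OreAlg q α) := by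
  change _ = Kashina.counitHom k h • _
  induction h using Kashina.induction with
  | h0 c => simp only [AlgHom.commutes, Module.algebraMap_end_apply]; rfl
  | h1 g =>
    rw [Kashina.counitHom_gen, action_gen, one_smul]
    cases g
    · exact map_one (opX _)
    · exact map_one (opY _)
    · exact map_one (opZ _ (piSign_mul_self i))
    · rw [← map_one (algebraMap ℂ (OreAlg q α))]
      exact opW_algebraMap ..
  | hm a b ha hb =>
    rw [map_mul, Module.End.mul_apply, hb, map_smul, ha, smul_smul, map_mul, mul_comm]
  | ha a b ha hb => rw [map_add, LinearMap.add_apply, ha, hb, map_add, add_smul]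

lemma action_isModuleAlgebra : IsModuleAlgebra (action i χ q α hχ) := by
  refine ⟨action_one i χ q α hχ, fun h => ?_⟩
  rw [compat_iff]
  induction h using Kashina.induction with
  | h0 c =>
    simp only [AlgHom.commutes]
    refine LinearMap.ext fun a => ?_
    simp only [LinearMap.comp_apply, Module.algebraMap_end_apply, map_smul]
  | h1 g =>
    rw [← compat_iff]
    intro a b
    rw [Kashina.comul_gen]
    cases g <;>
      simp only [Kashina.comulGen, TensorProduct.map_tmul, LinearMap.flip_apply,
        AlgHom.toLinearMap_apply, LinearMap.mul'_apply, action_gen, smul_mul_assoc, add_mul,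
        sub_mul, Algebra.TensorProduct.tmul_mul_tmul, one_mul, map_smul, map_add, map_sub,
        map_mul, Module.End.mul_apply]
    · exact map_mul (opX _) a b
    · exact map_mul (opY _) a b
    · exact map_mul (opZ _ (piSign_mul_self i)) a b
    · refine (opW_mul _ _ _ a b).trans ?_
      simp only [twistedMul, ← opX_opY (character_x_mul_self χ)]
      rfl
  | hm a b ha hb =>
    rw [map_mul, map_mul, map_mul, map_mul, Module.End.mul_eq_comp, Module.End.mul_eq_comp,
      LinearMap.comp_assoc, hb, ← LinearMap.comp_assoc, ha, LinearMap.comp_assoc]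
  | ha a b ha hb =>
    simp only [map_add, LinearMap.add_comp, LinearMap.comp_add, ha, hb]

/-- The action on `A₁ = ℂu ⊕ ℂv ⊕ ℂt` is `π_i ⊕ χ`. -/
lemma action_degree_one (h : Kashina k) :
    action i χ q α hχ h (u q α) = piRep k i h 0 0 • u q α + piRep k i h 1 0 • v q α ∧
    action i χ q α hχ h (v q α) = piRep k i h 0 1 • u q α + piRep k i h 1 1 • v q α ∧
    action i χ q α hχ h (t q α) = χ h • t q α := by
  induction h using Kashina.induction with
  | h0 c =>
    simp [Matrix.algebraMap_eq_diagonal, Module.algebraMap_end_apply]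
  | h1 g =>
    rw [action_gen, piRep_gen]
    cases g
    · simp [actionGen, opX, piMatrix]
    · simp [actionGen, opY, piMatrix, character_y]
    · simp [actionGen, opZ, piMatrix_z, hχ]
    · simp [actionGen, piMatrix_w]
  | hm a b ha hb =>
    simp only [map_mul, Module.End.mul_apply, hb, map_add, map_smul, ha, Matrix.mul_apply,
      Fin.sum_univ_two]
    refine ⟨?_, ?_, ?_⟩ <;> module
  | ha a b ha hb =>
    simp only [map_add, LinearMap.add_apply, ha, hb, Matrix.add_apply]
    refine ⟨?_, ?_, ?_⟩ <;> module

lemma action_mem_degreePart (n : ℕ) (h : Kashina k) (a : OreAlg q α)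
    (ha : a ∈ degreePart q α n) : action i χ q α hχ h a ∈ degreePart q α n := by
  refine (action_isModuleAlgebra i χ q α hχ).map_mem_pow (fun h a ha => ?_) n h a ha
  have hu : u q α ∈ Submodule.span ℂ {u q α, v q α, t q α} := Submodule.subset_span (by simp)
  have hv : v q α ∈ Submodule.span ℂ {u q α, v q α, t q α} := Submodule.subset_span (by simp)
  have ht : t q α ∈ Submodule.span ℂ {u q α, v q α, t q α} := Submodule.subset_span (by simp)
  obtain ⟨h0, h1, h2⟩ := action_degree_one i χ q α hχ h
  induction ha using Submodule.span_induction with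
  | mem a ha =>
    rcases ha with rfl | rfl | rfl
    · rw [h0]; exact add_mem (Submodule.smul_mem _ _ hu) (Submodule.smul_mem _ _ hv)
    · rw [h1]; exact add_mem (Submodule.smul_mem _ _ hu) (Submodule.smul_mem _ _ hv)
    · rw [h2]; exact Submodule.smul_mem _ _ ht
  | zero => rw [map_zero]; exact zero_mem _
  | add a b _ _ ha hb => rw [map_add]; exact add_mem ha hb
  | smul c a _ ha => rw [map_smul]; exact Submodule.smul_mem _ _ ha

end Action

/-! ### Hopf ideals that annihilate representations -/

section Coideal

variable {H : Type*} [Ring H] [HopfAlgebra ℂ H]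

/-- If a coideal annihilates two modules, it annihilates their tensor product. -/
lemma map_comul_eq_zero {M N : Type*} [AddCommGroup M] [Module ℂ M] [AddCommGroup N] [Module ℂ N]
    {J : Submodule ℂ H} (hJ : J.IsCoideal) {f : H →ₗ[ℂ] M} {g : H →ₗ[ℂ] N}
    (hf : ∀ h ∈ J, f h = 0) (hg : ∀ h ∈ J, g h = 0) {h : H} (hh : h ∈ J) :
    TensorProduct.map f g (Coalgebra.comul (R := ℂ) h) = 0 := by
  have hf' : f = J.liftQ f hf ∘ₗ J.mkQ := (Submodule.liftQ_mkQ ..).symm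
  have hg' : g = J.liftQ g hg ∘ₗ J.mkQ := (Submodule.liftQ_mkQ ..).symm
  rw [hf', hg', TensorProduct.map_comp, LinearMap.comp_apply, hJ.map_mkQ_comul_eq_zero hh,
    map_zero]

/-- The winding endomorphism `h ↦ ∑ h₁ χ(h₂)` attached to a character `χ` of `H`. -/
noncomputable def winding (χ : H →ₐ[ℂ] ℂ) : H →ₐ[ℂ] H :=
  (Algebra.TensorProduct.rid ℂ ℂ H).toAlgHom.comp
    ((Algebra.TensorProduct.map (AlgHom.id ℂ H) χ).comp (Bialgebra.comulAlgHom ℂ H))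

lemma winding_apply (χ : H →ₐ[ℂ] ℂ) (h : H) :
    winding χ h = Algebra.TensorProduct.rid ℂ ℂ H
      (Algebra.TensorProduct.map (AlgHom.id ℂ H) χ (Coalgebra.comul (R := ℂ) h)) := rfl

lemma winding_mem {J : Submodule ℂ H} (hJ : J.IsCoideal) {χ : H →ₐ[ℂ] ℂ}
    (hχ : ∀ h ∈ J, χ h = 0) {h : H} (hh : h ∈ J) : winding χ h ∈ J := by
  have key (X : H ⊗[ℂ] H) :
      J.mkQ (Algebra.TensorProduct.rid ℂ ℂ H
        (Algebra.TensorProduct.map (AlgHom.id ℂ H) χ X)) =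
      TensorProduct.rid ℂ _ (TensorProduct.map J.mkQ χ.toLinearMap X) := by
    induction X with
    | zero => simp
    | tmul a b => simp
    | add a b ha hb => simp only [map_add, ha, hb]
  rw [← Submodule.Quotient.mk_eq_zero, ← Submodule.mkQ_apply, winding_apply, key,
    map_comul_eq_zero hJ (fun a ha => by simpa using ha) hχ hh, map_zero]

end Coideal

/-! ### Detecting elements of `H` -/

namespace Kashina

variable {k : Index}

/-- For signs `a`, `b`, `c`, the idempotent of the group algebra of `⟨x, y, z⟩` that belongs to the
character `x ↦ a`, `y ↦ b`, `z ↦ c`. -/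
noncomputable def idem (k : Index) (a b c : ℂ) : Kashina k :=
  (1 / 8 : ℂ) • ((1 + a • gen k .x) * (1 + b • gen k .y) * (1 + c • gen k .z))

lemma eq_sum_idem_mul (h : Kashina k) :
    h = (idem k 1 1 1 + idem k 1 1 (-1) + idem k 1 (-1) 1 + idem k 1 (-1) (-1) + idem k (-1) 1 1 +
      idem k (-1) 1 (-1) + idem k (-1) (-1) 1 + idem k (-1) (-1) (-1)) * h := by
  have : idem k 1 1 1 + idem k 1 1 (-1) + idem k 1 (-1) 1 + idem k 1 (-1) (-1) + idem k (-1) 1 1 +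
      idem k (-1) 1 (-1) + idem k (-1) (-1) 1 + idem k (-1) (-1) (-1) = 1 := by
    simp only [idem, add_mul, mul_add, one_mul, mul_one, one_smul, smul_mul_assoc, mul_smul_comm]
    module
  rw [this, one_mul]

section idem

variable {a b c : ℂ}

lemma idem_mul_x (ha : a * a = 1) : idem k a b c * gen k .x = a • idem k a b c := by
  simp only [idem, add_mul, mul_add, one_mul, mul_one, smul_mul_assoc, mul_smul_comm, mul_assoc,
    xx, yx, zx, xx', yx', zx', smul_add, smul_smul]
  match_scalars <;> grind

lemma idem_mul_y (hb : b * b = 1) : idem k a b c * gen k .y = b • idem k a b c := by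
  simp only [idem, add_mul, mul_add, one_mul, mul_one, smul_mul_assoc, mul_smul_comm, mul_assoc,
    yy, zy, yy', zy', smul_add, smul_smul]
  match_scalars <;> grind

lemma idem_mul_z (hc : c * c = 1) : idem k a b c * gen k .z = c • idem k a b c := by
  simp only [idem, add_mul, mul_add, one_mul, mul_one, smul_mul_assoc, mul_smul_comm, mul_assoc,
    zz, zz', smul_add, smul_smul]
  match_scalars <;> grind

/-- `H` is spanned by `⟨x, y, z⟩` and `⟨x, y, z⟩ w`, so an eigenspace of `⟨x, y, z⟩` acting on `H`
from the left is spanned by two elements. -/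
lemma idem_mul_mem (ha : a * a = 1) (hb : b * b = 1) (hc : c * c = 1) (h : Kashina k) :
    ∃ A B : ℂ, A • idem k a b c + B • (idem k a b c * gen k .w) = idem k a b c * h := by
  set e := idem k a b c
  have hx : e * gen k .x = a • e := idem_mul_x ha
  have hy : e * gen k .y = b • e := idem_mul_y hb
  have hz : e * gen k .z = c • e := idem_mul_z hc
  rw [← Submodule.mem_span_pair]
  set S := Submodule.span ℂ {e, e * gen k .w}
  have he : e ∈ S := Submodule.subset_span (by simp)
  have hw : e * gen k .w ∈ S := Submodule.subset_span (by simp)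
  have key (h : Kashina k) : ∀ p ∈ S, p * h ∈ S := by
    induction h using induction with
    | h0 r =>
      intro p hp
      rw [Algebra.algebraMap_eq_smul_one, mul_smul_comm, mul_one]
      exact S.smul_mem _ hp
    | h1 g =>
      intro p hp
      obtain ⟨A, B, rfl⟩ := Submodule.mem_span_pair.mp hp
      rw [add_mul, smul_mul_assoc, smul_mul_assoc]
      refine add_mem (S.smul_mem _ ?_) (S.smul_mem _ ?_)
      · cases g
        · rw [hx]; exact S.smul_mem _ he
        · rw [hy]; exact S.smul_mem _ he
        · rw [hz]; exact S.smul_mem _ he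
        · exact hw
      · cases g
        · rw [mul_assoc, wx, ← mul_assoc, hy, smul_mul_assoc]; exact S.smul_mem _ hw
        · rw [mul_assoc, wy, ← mul_assoc, hx, smul_mul_assoc]; exact S.smul_mem _ hw
        · rw [mul_assoc, wz, ← mul_assoc, hz, smul_mul_assoc]; exact S.smul_mem _ hw
        · rw [mul_assoc, ww]
          cases k
          · rw [wSq_two, mul_one]; exact he
          · rw [wSq_four, hz]; exact S.smul_mem _ he
    | hm g h hg hh => intro p hp; rw [← mul_assoc]; exact hh _ (hg _ hp)
    | ha g h hg hh => intro p hp; rw [mul_add]; exact add_mem (hg _ hp) (hh _ hp)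
  exact key h e he

end idem

/-- With `e` the idempotent of the character `x ↦ a`, `y ↦ b`, `z ↦ c`: the elements `e` and `ew`,
which span the eigenspace `eH`, are linearly independent modulo the subspace `J` of `H`. -/
def Separates (J : Submodule ℂ (Kashina k)) (a b c : ℂ) : Prop :=
  ∀ A B : ℂ, A • idem k a b c + B • (idem k a b c * gen k .w) ∈ J → A = 0 ∧ B = 0

/-- If a matrix representation `ψ` vanishes on `J` and, in `ψ`, `x`, `y`, `z` are diagonal with
signs in position `j`, and row `j` of `w` vanishes at `j` but not at `l`, then `e` and `ew` are
linearly independent modulo `J`: the entries `(j, j)` and `(j, l)` read off the two coefficients. -/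
lemma separates_of_matrix {J : Submodule ℂ (Kashina k)} {n : Type*} [Fintype n] [DecidableEq n]
    {ψ : Kashina k →ₐ[ℂ] Matrix n n ℂ} (hψ : ∀ h ∈ J, ψ h = 0) {dx dy dz : n → ℂ}
    (hx : ψ (gen k .x) = Matrix.diagonal dx) (hy : ψ (gen k .y) = Matrix.diagonal dy)
    (hz : ψ (gen k .z) = Matrix.diagonal dz) {j l : n} (hjl : j ≠ l)
    (hx1 : dx j * dx j = 1) (hy1 : dy j * dy j = 1) (hz1 : dz j * dz j = 1)
    (hjj : ψ (gen k .w) j j = 0) (hw : ψ (gen k .w) j l ≠ 0) :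
    Separates J (dx j) (dy j) (dz j) := by
  intro A B h
  have he : ψ (idem k (dx j) (dy j) (dz j)) = Matrix.diagonal fun m =>
      (1 / 8 : ℂ) * ((1 + dx j * dx m) * (1 + dy j * dy m) * (1 + dz j * dz m)) := by
    simp only [idem, map_smul, map_mul, map_add, map_one, hx, hy, hz, ← Matrix.diagonal_one,
      ← Matrix.diagonal_smul, Matrix.diagonal_add, Matrix.diagonal_mul_diagonal]
    rfl
  have h1 := hψ _ h
  rw [map_add, map_smul, map_smul, map_mul, he] at h1
  have hj := congrFun (congrFun h1 j) j
  have hl := congrFun (congrFun h1 j) l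
  simp only [Matrix.add_apply, Matrix.smul_apply, Matrix.diagonal_apply_eq,
    Matrix.diagonal_apply_ne _ hjl, Matrix.diagonal_mul, hx1, hy1, hz1, hjj, smul_eq_mul,
    Matrix.zero_apply] at hj hl
  norm_num at hj hl
  exact ⟨hj, hl.resolve_right hw⟩

section winding

variable (χ : Kashina k →ₐ[ℂ] ℂ)

lemma winding_x : winding χ (gen k .x) = χ (gen k .x) • gen k .x := by
  rw [winding_apply, comul_gen]; simp [comulGen]

lemma winding_y : winding χ (gen k .y) = χ (gen k .x) • gen k .y := by
  rw [winding_apply, comul_gen]; simp [comulGen, character_y]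

lemma winding_z (hχ : χ (gen k .z) = -1) : winding χ (gen k .z) = -gen k .z := by
  rw [winding_apply, comul_gen]; simp [comulGen, hχ]

lemma winding_w : winding χ (gen k .w) = χ (gen k .w) • gen k .w := by
  rw [winding_apply, comul_gen]
  simp only [comulGen, smul_mul_assoc, add_mul, sub_mul, Algebra.TensorProduct.tmul_mul_tmul,
    one_mul, map_smul, map_add, map_sub, Algebra.TensorProduct.map_tmul, AlgHom.id_apply,
    map_mul, Algebra.TensorProduct.rid_tmul, character_y, character_x_mul_self]
  module

/-- The winding endomorphism of `χ` permutes the eigenspaces. It changes the sign of `c`. -/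
lemma separates_of_winding (hχ : χ (gen k .z) = -1) {J : Submodule ℂ (Kashina k)}
    (hJ : J.IsCoideal) (hχJ : ∀ h ∈ J, χ h = 0) {a b c : ℂ}
    (h : Separates J (χ (gen k .x) * a) (χ (gen k .x) * b) (-c)) : Separates J a b c := by
  intro A B hAB
  have h1 := winding_mem hJ hχJ hAB
  have he : winding χ (idem k a b c) =
      idem k (χ (gen k .x) * a) (χ (gen k .x) * b) (-c) := by
    simp only [idem, map_smul, map_mul, map_add, map_one, winding_x, winding_y, winding_z χ hχ,
      smul_smul, mul_comm a, mul_comm b, smul_neg, neg_smul]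
  rw [map_add, map_smul, map_smul, map_mul, he, winding_w, mul_smul_comm, smul_smul] at h1
  obtain ⟨hA, hB⟩ := h _ _ h1
  exact ⟨hA, (mul_eq_zero.mp hB).resolve_right (character_w_ne_zero χ)⟩

end winding

section pi

variable (i : PiIndex)

lemma piRep_x : piRep k i (gen k .x) = Matrix.diagonal ![1, -1] := by
  rw [piRep_gen, piMatrix, Matrix.diagonal_vec2]

lemma piRep_y : piRep k i (gen k .y) = Matrix.diagonal ![-1, 1] := by
  rw [piRep_gen, piMatrix, Matrix.diagonal_vec2]

lemma piRep_z : piRep k i (gen k .z) = Matrix.diagonal ![piSign i, piSign i] := by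
  rw [piRep_gen, piMatrix_z, Matrix.diagonal_vec2]

lemma piRep_w : piRep k i (gen k .w) = !![0, piScalar k i; piScalar k i, 0] := by
  rw [piRep_gen, piMatrix_w]

/-- The representation `π_i ⊗ π_i`, in matrix form. -/
noncomputable def piSq (k : Index) (i : PiIndex) :
    Kashina k →ₐ[ℂ] Matrix (Fin 2 × Fin 2) (Fin 2 × Fin 2) ℂ :=
  (Matrix.kroneckerAlgEquiv (Fin 2) (Fin 2) ℂ).toAlgHom.comp
    ((Algebra.TensorProduct.map (piRep k i) (piRep k i)).comp
      (Bialgebra.comulAlgHom ℂ (Kashina k)))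

lemma piSq_x : piSq k i (gen k .x) =
    Matrix.diagonal fun m => (![1, -1] m.1 * ![1, -1] m.2 : ℂ) := by
  simp [piSq, comul_gen, comulGen, piRep_x, Matrix.diagonal_kronecker_diagonal]

lemma piSq_y : piSq k i (gen k .y) =
    Matrix.diagonal fun m => (![-1, 1] m.1 * ![-1, 1] m.2 : ℂ) := by
  simp [piSq, comul_gen, comulGen, piRep_y, Matrix.diagonal_kronecker_diagonal]

lemma piSq_z : piSq k i (gen k .z) =
    Matrix.diagonal fun m => (![piSign i, piSign i] m.1 * ![piSign i, piSign i] m.2 : ℂ) := by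
  simp [piSq, comul_gen, comulGen, piRep_z, Matrix.diagonal_kronecker_diagonal]

open scoped Kronecker in
/-- On `π_i`, `xy` acts as `-1` and `z` as a sign `s`, so that the factor
`½ (1 + xy + z - z ⊗ xy)` of `Δ(w)` acts on `π_i ⊗ π_i` as `½ (1 - 1 + s + s) = s`. -/
lemma piSq_w : piSq k i (gen k .w) =
    piSign i • (piRep k i (gen k .w) ⊗ₖ piRep k i (gen k .w)) := by
  have hxy : piRep k i (gen k .x) * piRep k i (gen k .y) = -1 := by
    rw [piRep_x, piRep_y, Matrix.diagonal_mul_diagonal, ← Matrix.diagonal_one,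
      Matrix.diagonal_neg]
    congr 1; funext j; fin_cases j <;> simp
  have hz : piRep k i (gen k .z) = piSign i • (1 : Matrix (Fin 2) (Fin 2) ℂ) := by
    rw [piRep_z, Matrix.smul_one_eq_diagonal]
    congr 1; funext j; fin_cases j <;> simp
  have h : Algebra.TensorProduct.map (piRep k i) (piRep k i) (comulGen k .w) =
      piSign i • (piRep k i (gen k .w) ⊗ₜ[ℂ] piRep k i (gen k .w)) := by
    simp only [comulGen, smul_mul_assoc, add_mul, sub_mul, Algebra.TensorProduct.tmul_mul_tmul,
      one_mul, map_smul, map_add, map_sub, Algebra.TensorProduct.map_tmul, map_mul, hxy, hz,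
      neg_mul, ← TensorProduct.smul_tmul', TensorProduct.tmul_neg]
    module
  change Matrix.kroneckerAlgEquiv (Fin 2) (Fin 2) ℂ (Algebra.TensorProduct.map (piRep k i)
    (piRep k i) (Coalgebra.comul (R := ℂ) (gen k .w))) = _
  rw [comul_gen, h, map_smul]
  rfl

variable {i} {J : Submodule ℂ (Kashina k)} {χ : Kashina k →ₐ[ℂ] ℂ} {a b c : ℂ}

/-- `π_i` detects the characters of `⟨x, y, z⟩` that are `-1` at `xy` and agree with `π_i`
at `z`. -/
lemma separates_of_piRep (hπ : ∀ h ∈ J, piRep k i h = 0) (ha : a * a = 1) :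
    Separates J a (-a) (piSign i) := by
  rcases mul_self_eq_one_iff.mp ha with rfl | rfl
  · simpa using separates_of_matrix hπ (piRep_x i) (piRep_y i) (piRep_z i) (j := 0) (l := 1)
      (by simp) (by simp) (by simp) (by simp [piSign_mul_self]) (by simp [piRep_w])
      (by simp [piRep_w, piScalar_ne_zero])
  · simpa using separates_of_matrix hπ (piRep_x i) (piRep_y i) (piRep_z i) (j := 1) (l := 0)
      (by simp) (by simp) (by simp) (by simp [piSign_mul_self]) (by simp [piRep_w])
      (by simp [piRep_w, piScalar_ne_zero])

/-- `π_i ⊗ π_i` detects the characters of `⟨x, y, z⟩` that are `1` at `xy` and at `z`: `w` swaps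
`u ⊗ u` with `v ⊗ v` and `u ⊗ v` with `v ⊗ u`, up to a scalar. -/
lemma separates_of_piSq (hJ : J.IsCoideal) (hπ : ∀ h ∈ J, piRep k i h = 0) (ha : a * a = 1) :
    Separates J a a 1 := by
  have hs : piSign i ≠ 0 := left_ne_zero_of_mul_eq_one (piSign_mul_self i)
  have hψ : ∀ h ∈ J, piSq k i h = 0 := by
    intro h hh
    have h0 : Algebra.TensorProduct.map (piRep k i) (piRep k i)
        (Coalgebra.comul (R := ℂ) h) = 0 :=
      map_comul_eq_zero hJ (f := (piRep k i).toLinearMap) (g := (piRep k i).toLinearMap) hπ hπ hh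
    exact (congrArg (Matrix.kroneckerAlgEquiv (Fin 2) (Fin 2) ℂ) h0).trans (map_zero _)
  rcases mul_self_eq_one_iff.mp ha with rfl | rfl
  · simpa [piSign_mul_self] using separates_of_matrix hψ (piSq_x i) (piSq_y i) (piSq_z i)
      (j := (0, 0)) (l := (1, 1)) (by simp) (by simp) (by simp) (by simp [piSign_mul_self])
      (by simp [piSq_w, piRep_w]) (by simp [piSq_w, piRep_w, piScalar_ne_zero, hs])
  · simpa [piSign_mul_self] using separates_of_matrix hψ (piSq_x i) (piSq_y i) (piSq_z i)
      (j := (0, 1)) (l := (1, 0)) (by simp) (by simp) (by simp) (by simp [piSign_mul_self])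
      (by simp [piSq_w, piRep_w]) (by simp [piSq_w, piRep_w, piScalar_ne_zero, hs])

/-- Winding by `χ` supplies the sign of `z` that `π_i` and `π_i ⊗ π_i` miss. -/
lemma separates (hJ : J.IsCoideal) (hπ : ∀ h ∈ J, piRep k i h = 0)
    (hχ : χ (gen k .z) = -1) (hχJ : ∀ h ∈ J, χ h = 0)
    (ha : a * a = 1) (hb : b * b = 1) (hc : c * c = 1) : Separates J a b c := by
  have hξa : χ (gen k .x) * a * (χ (gen k .x) * a) = 1 := by
    rw [mul_mul_mul_comm, character_x_mul_self, ha, one_mul]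
  rcases mul_self_eq_mul_self_iff.mp (hb.trans ha.symm) with rfl | rfl
  · rcases mul_self_eq_one_iff.mp hc with rfl | rfl
    · exact separates_of_piSq hJ hπ ha
    · refine separates_of_winding χ hχ hJ hχJ ?_
      rw [neg_neg]
      exact separates_of_piSq hJ hπ hξa
  · rcases mul_self_eq_mul_self_iff.mp (hc.trans (piSign_mul_self i).symm) with rfl | rfl
    · exact separates_of_piRep hπ ha
    · refine separates_of_winding χ hχ hJ hχJ ?_
      rw [neg_neg, mul_neg]
      exact separates_of_piRep hπ hξa

/-- A Hopf ideal that annihilates `π_i` and `χ` is zero. -/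
lemma eq_bot_of_annihilates (I : Ideal (Kashina k)) (hI : I.IsHopfIdeal ℂ)
    (hπ : ∀ h ∈ I, piRep k i h = 0) (hχ : χ (gen k .z) = -1) (hχI : ∀ h ∈ I, χ h = 0) :
    I = ⊥ := by
  refine (Submodule.eq_bot_iff _).mpr fun h hh => ?_
  have key {a b c : ℂ} (ha : a * a = 1) (hb : b * b = 1) (hc : c * c = 1) :
      idem k a b c * h = 0 := by
    obtain ⟨A, B, hAB⟩ := idem_mul_mem ha hb hc h
    obtain ⟨rfl, rfl⟩ := separates (J := I.restrictScalars ℂ) hI.toIsCoideal hπ hχ hχI ha hb hc A B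
      (by rw [hAB]; exact I.mul_mem_left _ hh)
    rw [← hAB, zero_smul, zero_smul, add_zero]
  rw [eq_sum_idem_mul h]
  simp only [add_mul]
  simp [key]

end pi

end Kashina

section Action

open OreAlg

/-- The action is inner-faithful already because of the summands `π_i` and `χ` of `A₁`. -/
lemma action_isInnerFaithful {k : Index} (i : PiIndex) (χ : Kashina k →ₐ[ℂ] ℂ) (q : QuadRel)
    (α : ℂ) (hχ : χ (Kashina.gen k .z) = -1) : IsInnerFaithful (action i χ q α hχ) := by
  intro I _ hI hann
  have hli := Fintype.linearIndependent_iff.mp (linearIndependent_generators (q := q) (α := α))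
  have coeffs (a b c : ℂ) (h : a • u q α + b • v q α + c • t q α = 0) :
      a = 0 ∧ b = 0 ∧ c = 0 := by
    have := hli ![a, b, c] (by simpa [Fin.sum_univ_three] using h)
    exact ⟨this 0, this 1, this 2⟩
  refine Kashina.eq_bot_of_annihilates (i := i) I hI (fun h hh => ?_) hχ fun h hh => ?_
  · obtain ⟨hu, hv, -⟩ := action_degree_one i χ q α hχ h
    rw [hann h hh] at hu hv
    obtain ⟨h00, h10, -⟩ := coeffs (piRep k i h 0 0) (piRep k i h 1 0) 0
      (by rw [zero_smul, add_zero]; exact hu.symm)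
    obtain ⟨h01, h11, -⟩ := coeffs (piRep k i h 0 1) (piRep k i h 1 1) 0
      (by rw [zero_smul, add_zero]; exact hv.symm)
    ext m n
    fin_cases m <;> fin_cases n
    exacts [h00, h01, h10, h11]
  · obtain ⟨-, -, ht⟩ := action_degree_one i χ q α hχ h
    rw [hann h hh] at ht
    exact (coeffs 0 0 _ (by rw [zero_smul, zero_smul, zero_add, zero_add]; exact ht.symm)).2.2

end Action

end KashinaSixteen

theorem mainTheorem8 (k : KashinaSixteen.Index) (i : KashinaSixteen.PiIndex)
    (χ : KashinaSixteen.Kashina k →ₐ[ℂ] ℂ) (hχ : χ (KashinaSixteen.Kashina.gen k .z) = -1)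
    (q : KashinaSixteen.QuadRel) (α : ℂ) (hα : α ≠ 0) :
    ∃ ρ : KashinaSixteen.Kashina k →ₐ[ℂ] Module.End ℂ (KashinaSixteen.OreAlg q α),
      -- `A` is an `H`-module algebra and the action preserves the grading of `A`
      KashinaSixteen.IsModuleAlgebra ρ ∧
      (∀ (n : ℕ) (h : KashinaSixteen.Kashina k), ∀ a ∈ KashinaSixteen.OreAlg.degreePart q α n,
        ρ h a ∈ KashinaSixteen.OreAlg.degreePart q α n) ∧
      -- `A₁` has the basis `u, v, t`, and as an `H`-module it is `π_i(u, v) ⊕ T(t)`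
      LinearIndependent ℂ ![KashinaSixteen.OreAlg.u q α, KashinaSixteen.OreAlg.v q α,
        KashinaSixteen.OreAlg.t q α] ∧
      (∀ h : KashinaSixteen.Kashina k,
        ρ h (KashinaSixteen.OreAlg.u q α) =
            KashinaSixteen.piRep k i h 0 0 • KashinaSixteen.OreAlg.u q α +
              KashinaSixteen.piRep k i h 1 0 • KashinaSixteen.OreAlg.v q α ∧
        ρ h (KashinaSixteen.OreAlg.v q α) =
            KashinaSixteen.piRep k i h 0 1 • KashinaSixteen.OreAlg.u q α +
              KashinaSixteen.piRep k i h 1 1 • KashinaSixteen.OreAlg.v q α ∧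
        ρ h (KashinaSixteen.OreAlg.t q α) = χ h • KashinaSixteen.OreAlg.t q α) ∧
      KashinaSixteen.IsInnerFaithful ρ :=
  ⟨KashinaSixteen.action i χ q α hχ, KashinaSixteen.action_isModuleAlgebra i χ q α hχ,
    KashinaSixteen.action_mem_degreePart i χ q α hχ,
    KashinaSixteen.OreAlg.linearIndependent_generators,
    KashinaSixteen.action_degree_one i χ q α hχ,
    KashinaSixteen.action_isInnerFaithful i χ q α hχ⟩
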